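/- Let $a>0$, $p=\frac{a^2}{1+a^2}$ and $N\ge 1$. Let $W_n=\{x\in\mathbb Z^n: x_1<\dots<x_n\}$, $\Delta_n(x)=\prod_{i<j}(x_j-x_i)$, and for $y\in W_{n-1}$, $x\in W_n$ write $y\prec x$ if $x_1<y_1\le x_2<y_2\le\dots<y_{n-1}\le x_n$. For $\tau\in\mathbb Z$ put $p(\tau)=p$ if $\tau\ge 0$ and $p(\tau)=0$ if $\tau<0$, let $\mathbf P(\tau)(u,v)=p(\tau)\delta_{v,u+1}+(1-p(\tau))\delta_{v,u}$, and define $$P_n(\tau)(x,y)=\frac{\Delta_n(y)}{\Delta_n(x)}\det[\mathbf P(\tau)(x_i,y_j)]_{i,j=1}^n,\qquad \Lambda^n_{n-1}(x,y)=(n-1)!\,\frac{\Delta_{n-1}(y)}{\Delta_n(x)}\mathbf 1_{[y\prec x]},\qquad \Delta^n_{n-1}(\tau)=P_n(\tau)\Lambda^n_{n-1}.$$ Write $\Delta^n_{n-1}=\Delta^n_{n-1}(0)$ for the composition with jump probability $p$. Consider configurations $(X,Y)$ with $X=(x^1,\dots,x^N)$, $x^n\in W_n$, and $Y=(y^2,\dots,y^N)$,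 $y^n\in W_{n-1}$. The extended state space consists of those with $\Delta^n_{n-1}(x^n,x^{n-1})>0$ and $y^n\prec x^n$ for $2\le n\le N$, and $\Delta^n_{n-1}(y^{n+1},y^n)>0$ for $2\le n\le N-1$. Consider the Markov chain with parallel update that starts at time $0$ from the packed configuration $x^n_k=-n+k-1$, $y^n=x^{n-1}$, and whose transition from time $t$ to time $t+1$ is given by $y^{n}(t+1)=x^{n-1}(t)$ for $2\le n\le N$ together with the weight $$P_1(t)(x^1(t),x^1(t+1))\prod_{n=2}^N\frac{P_n(t-n+1)(x^n(t),x^n(t+1))\,\Lambda^n_{n-1}(x^n(t+1),x^{n-1}(t))}{\Delta^n_{n-1}(t-n+1)(x^n(t),x^{n-1}(t))}$$ (so level $n$ can move for the first time in the step from time $n-1$ to time $n$; a quotient with denominator $0$ is read as $0$). Then the law of this chain at time $N$ is a probability measure, supported on the extended state space, and there is a constant $C$, depending only on $a$ and $N$, such that the probability of every configuration $(X,Y)$ equals $$C\,\det[\tilde\Psi_j^N(x_i^N)]_{i,j=1}^N\prod_{n=2}^{N}\det[\phi(x_i^n,y_j^n)]_{i,j=1}^n\,\det[f(x^{n-1}_j-y^n_i)]_{i,j=1}^{n-1},$$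 where $$\tilde\Psi_j^N(x)=\frac1{2\pi i}\oint_{|z|=1}(1-z)^{N-j}z^{x+j-1}(1-p+pz^{-1})\,dz,\qquad f(m)=p\,\delta_{m,1}+(1-p)\,\delta_{m,0},$$ $\phi(x,y)=\mathbf 1_{[y>x]}$, and $y^n_n=\mathrm{virt}$ is a virtual variable with $\phi(x,\mathrm{virt})=1$. Moreover this is the law of the line ensemble of a random domino tiling of the Aztec diamond $A_N$ of size $N$ (the union of the unit lattice squares inside $|x|+|y|\le N+1$), where a tiling $T$ has probability proportional to $a^{v(T)}$ and $v(T)$ is the number of vertical dominoes. Here a horizontal domino $[c,c+2]\times[r,r+1]$ is South if $c-r-N$ is odd and North otherwise, and a vertical domino $[c,c+1]\times[r,r+2]$ is East if $c-r-N$ is even and West otherwise. In coordinates (line-time, height) a South domino draws an edge from $(c-r+N,r)$ to $(c-r+N+1,r)$, an East domino from $(c-r+N-1,r+1)$ to $(c-r+N,r)$, a West domino from $(c-r+N,r)$ to $(c-r+N,r+1)$, and a North domino draws nothing. The particles $x^n$ ($1\le n\le N$) are the heights at which edges go from line-time $2n-1$ to $2n$, and the particles $y^{n+1}$ ($1\le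 n\le N-1$) are the heights at which these edges arrive at line-time $2n$. -/

import Mathlib

open scoped BigOperators

noncomputable section

namespace AztecChain

/-! ### Weyl chambers, one-level transitions and Markov links -/

/-- The Weyl chamber `W_n`: strictly increasing vectors in `ℤ^n`. -/
abbrev Weyl (n : ℕ) : Type := {x : Fin n → ℤ // StrictMono x}

/-- The Vandermonde determinant `Δ_n(x) = ∏_{i<j} (x_j - x_i)`. -/
def vandermonde {n : ℕ} (x : Weyl n) : ℝ :=
  ∏ i : Fin n, ∏ j ∈ Finset.Ioi i, ((x.1 j : ℝ) - (x.1 i : ℝ))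

/-- One-particle transition matrix: a step `+1` with probability `p`, no step otherwise. -/
def stepMatrix (p : ℝ) (x y : ℤ) : ℝ :=
  if y = x + 1 then p else if y = x then 1 - p else 0

/-- The level-`n` transition probability
`P_n(x,y) = Δ_n(y) / Δ_n(x) * det [P(x_i, y_j)]`. -/
def levelTransition {n : ℕ} (p : ℝ) (x y : Weyl n) : ℝ :=
  vandermonde y / vandermonde x *
    (Matrix.of fun i j : Fin n => stepMatrix p (x.1 i) (y.1 j)).det

/-- `y ≺ x`: `x_1 < y_1 ≤ x_2 < y_2 ≤ ... < y_n ≤ x_{n+1}`. -/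
def Interlaces {n : ℕ} (y : Weyl n) (x : Weyl (n + 1)) : Prop :=
  ∀ i : Fin n, x.1 i.castSucc < y.1 i ∧ y.1 i ≤ x.1 i.succ

open Classical in
/-- The Markov link `Λ^{n+1}_n(x,y) = n! Δ_n(y) / Δ_{n+1}(x) 1_{y ≺ x}`. -/
def link {n : ℕ} (x : Weyl (n + 1)) (y : Weyl n) : ℝ :=
  (n.factorial : ℝ) * (vandermonde y / vandermonde x) * (if Interlaces y x then 1 else 0)

/-- The composition `Δ^{n+1}_n = P_{n+1} Λ^{n+1}_n`, with jump probability `p`.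
The sum has finitely many non-zero terms. -/
def linkStep {n : ℕ} (p : ℝ) (x : Weyl (n + 1)) (y : Weyl n) : ℝ :=
  ∑' z : Weyl (n + 1), levelTransition p x z * link z y

/-! ### The chain with parallel update on the extended state space

The number of levels is `N = M + 1`, so that levels and particles can be indexed from `0`. -/

/-- A configuration of `x`- and `y`-particles with `N = M + 1` levels.
`x k` is the vector `x^{k+1} ∈ W_{k+1}` for `0 ≤ k < N`, and
`y k` is the vector `y^{k+2} ∈ W_{k+1}` for `0 ≤ k < N - 1`. -/
structure Config (M : ℕ) where
  x : (k : Fin (M + 1)) → Weyl (k + 1)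
  y : (k : Fin M) → Weyl (k + 1)

/-- The jump probability `p = a² / (1 + a²)`. -/
def jumpProb (a : ℝ) : ℝ := a ^ 2 / (1 + a ^ 2)

/-- The jump probability used in `P_n(τ)`: `p` for `τ ≥ 0`, and `0` for `τ < 0`. -/
def jumpProbAt (a : ℝ) (τ : ℤ) : ℝ := if 0 ≤ τ then jumpProb a else 0

/-- The extended state space: `Δ^n_{n-1}(x^n, x^{n-1}) > 0` and `y^n ≺ x^n` for `2 ≤ n ≤ N`, and
`Δ^n_{n-1}(y^{n+1}, y^n) > 0` for `2 ≤ n ≤ N - 1`. -/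
def extendedStateSpace (a : ℝ) (M : ℕ) : Set (Config M) :=
  {s | (∀ k : Fin M, 0 < linkStep (jumpProb a) (s.x k.succ) (s.x k.castSucc)) ∧
    (∀ k : Fin M, Interlaces (s.y k) (s.x k.succ)) ∧
    (∀ (k : ℕ) (h : k + 1 < M),
      0 < linkStep (n := k + 1) (jumpProb a) (s.y ⟨k + 1, h⟩) (s.y ⟨k, Nat.lt_of_succ_lt h⟩))}

/-- The packed vector `(-n, ..., -1)`. -/
def packedVector (n : ℕ) : Weyl n :=
  ⟨fun i => (i : ℤ) - n, fun i j h => by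
    have : (i : ℕ) < (j : ℕ) := h
    simp only
    omega⟩

/-- The packed initial condition `x^n_k = -n + k - 1`, and `y^n = x^{n-1}`. -/
def packed (M : ℕ) : Config M where
  x k := packedVector (k + 1)
  y k := packedVector (k + 1)

open Classical in
/-- The one-time transition from time `t` to time `t + 1` on the extended state space.
The `y`-particles are updated by `y^{n+1}(t+1) = x^n(t)`.  The `x`-particles are updated by the
parallel update, where level `n` uses `P_n(τ)` with `τ = t - n + 1`:
`P_1(x^1(t), x^1(t+1)) ∏_{n=2}^N P_n(x^n(t), x^n(t+1)) Λ^n_{n-1}(x^n(t+1), x^{n-1}(t))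
  / Δ^n_{n-1}(x^n(t), x^{n-1}(t))`.
The index `k` in the product is the level `n = k + 2`. -/
def transition (a : ℝ) (M : ℕ) (t : ℕ) (s s' : Config M) : ℝ :=
  (if ∀ k : Fin M, s'.y k = s.x k.castSucc then 1 else 0) *
    (levelTransition (jumpProbAt a t) (s.x 0) (s'.x 0) *
      ∏ k : Fin M,
        levelTransition (jumpProbAt a ((t : ℤ) - (k : ℤ) - 1)) (s.x k.succ) (s'.x k.succ) *
          link (s'.x k.succ) (s.x k.castSucc) /
            linkStep (jumpProbAt a ((t : ℤ) - (k : ℤ) - 1)) (s.x k.succ) (s.x k.castSucc))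

open Classical in
/-- The law at time `t` of the chain started from the packed initial condition.
The law has finite support, so that the sum has finitely many non-zero terms. -/
def chainLaw (a : ℝ) (M : ℕ) : ℕ → Config M → ℝ
  | 0, s => if s = packed M then 1 else 0
  | t + 1, s' => ∑' s : Config M, chainLaw a M t s * transition a M t s s'

/-! ### Domino tilings of the Aztec diamond and their lines

The lattice square `[c, c+1] × [r, r+1]` is denoted by its lower left corner `(c, r)`. -/

/-- `horizontal c r` is `[c, c+2] × [r, r+1]`, and `vertical c r` is `[c, c+1] × [r, r+2]`. -/
inductive Domino : Type
  | horizontal (c r : ℤ)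
  | vertical (c r : ℤ)
  deriving DecidableEq

/-- The two lattice squares of a domino. -/
def Domino.squares : Domino → Finset (ℤ × ℤ)
  | .horizontal c r => {(c, r), (c + 1, r)}
  | .vertical c r => {(c, r), (c, r + 1)}

/-- Whether a domino is vertical. -/
def Domino.IsVertical : Domino → Prop
  | .horizontal _ _ => False
  | .vertical _ _ => True

/-- The squares of the Aztec diamond of size `N`: all lattice squares inside
`{(x, y) : |x| + |y| ≤ N + 1}` (stated for the corner of the square that is farthest away
from the origin). -/
def aztecSquares (N : ℕ) : Finset (ℤ × ℤ) :=
  (Finset.Icc (-(N : ℤ) - 1) (N + 1) ×ˢ Finset.Icc (-(N : ℤ) - 1) (N + 1)).filter fun q =>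
    max |q.1| |q.1 + 1| + max |q.2| |q.2 + 1| ≤ (N : ℤ) + 1

/-- The dominoes that lie inside the Aztec diamond of size `N`. -/
def aztecDominoes (N : ℕ) : Finset Domino :=
  ((aztecSquares N).image (fun q => Domino.horizontal q.1 q.2) ∪
    (aztecSquares N).image (fun q => Domino.vertical q.1 q.2)).filter fun d =>
      d.squares ⊆ aztecSquares N

open Classical in
/-- The domino tilings of the Aztec diamond of size `N`: sets of dominoes inside it such that every
square is covered by exactly one domino. -/
def tilings (N : ℕ) : Finset (Finset Domino) :=
  (aztecDominoes N).powerset.filter fun T =>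
    ∀ q ∈ aztecSquares N, ∃! d : Domino, d ∈ T ∧ q ∈ d.squares

open Classical in
/-- The number `v(T)` of vertical dominoes. -/
def verticalCount (T : Finset Domino) : ℕ := (T.filter Domino.IsVertical).card

/-- The edge of the LGV graph, from `(t, h)` to `(t', h')`, that is drawn by a domino.

With the checkerboard colouring, a horizontal domino `(c, r)` is of South type iff `c - r - N` is
odd (the type of those in the bottom row) and of North type otherwise; a vertical domino `(c, r)` is
of East type iff `c - r - N` is even (the type of the one that fits in the right corner) and of
West type otherwise.  In the plane, the line goes
from `(c, r + 1/2)` to `(c + 2, r + 1/2)` in a South domino,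
from `(c, r + 1/2)` to `(c + 1, r + 3/2)` in a West domino,
from `(c, r + 3/2)` to `(c + 1, r + 1/2)` in an East domino,
and there is no line in a North domino.  A point `(X, Y)` is moved to the line-time
`t = X - Y + N + 1/2` and the height `h = Y - 1/2`.  After this, a West domino draws a vertical edge
at an odd line-time `t`, while South and East dominoes draw lines from an odd `t` to `t + 2`; the LGV
graph uses a horizontal or a down-right edge from `t` to `t + 1`, which is the edge recorded here, and
then the horizontal edge from `t + 1` to `t + 2`. -/
def Domino.lgvEdge (N : ℕ) : Domino → Option ((ℤ × ℤ) × (ℤ × ℤ))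
  | .horizontal c r =>
      if Odd (c - r - (N : ℤ)) then some ((c - r + N, r), (c - r + N + 1, r)) else none
  | .vertical c r =>
      if Even (c - r - (N : ℤ)) then some ((c - r + N - 1, r + 1), (c - r + N, r))
      else some ((c - r + N, r), (c - r + N, r + 1))

/-- The heights at which the lines of a tiling leave the line-time `t` (to line-time `t + 1`). -/
def leavingHeights (N : ℕ) (T : Finset Domino) (t : ℤ) : Set ℤ :=
  {h | ∃ d ∈ T, ∃ h' : ℤ, d.lgvEdge N = some ((t, h), (t + 1, h'))}

/-- The heights at which the lines of a tiling arrive at the line-time `t` (from `t - 1`). -/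
def arrivingHeights (N : ℕ) (T : Finset Domino) (t : ℤ) : Set ℤ :=
  {h | ∃ d ∈ T, ∃ h' : ℤ, d.lgvEdge N = some ((t - 1, h'), (t, h))}

/-- The line ensemble of the tiling `T` of the Aztec diamond of size `N = M + 1` is the one of the
configuration `s`: the particles of `x^n` are at line-time `2n - 1`, and those of `y^{n+1}` are at
line-time `2n`. -/
def HasLineEnsemble (M : ℕ) (T : Finset Domino) (s : Config M) : Prop :=
  (∀ k : Fin (M + 1), Set.range (s.x k).1 = leavingHeights (M + 1) T (2 * (k : ℤ) + 1)) ∧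
    ∀ k : Fin M, Set.range (s.y k).1 = arrivingHeights (M + 1) T (2 * (k : ℤ) + 2)

open Classical in
/-- The law of the line ensemble of a random tiling of the Aztec diamond of size `M + 1`, where a
tiling `T` has probability `a^{v(T)} / ∑_S a^{v(S)}`. -/
def aztecLaw (a : ℝ) (M : ℕ) (s : Config M) : ℝ :=
  ∑ T ∈ (tilings (M + 1)).filter (fun T => HasLineEnsemble M T s),
    a ^ verticalCount T / ∑ S ∈ tilings (M + 1), a ^ verticalCount S

/-! ### The product of determinants -/

/-- `Ψ̃_j^N(x) = (2πi)⁻¹ ∮ (1 - z)^{N-j} z^{x+j-1} (1 - p + p z⁻¹) dz` around `0`, for `1 ≤ j ≤ N`. -/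
def psiTilde (p : ℝ) (N j : ℕ) (x : ℤ) : ℂ :=
  (2 * (Real.pi : ℂ) * Complex.I)⁻¹ *
    ∮ z in C(0, 1), (1 - z) ^ (N - j) * z ^ (x + (j : ℤ) - 1) * (1 - (p : ℂ) + (p : ℂ) * z⁻¹)

/-- `φ(x, y) = 1_{y > x}`, and `φ(x, virt) = 1` for the virtual variable `virt = none`. -/
def phi (x : ℤ) : Option ℤ → ℝ
  | some y => if x < y then 1 else 0
  | none => 1

/-- The vector `y ∈ W_n` followed by the virtual variable. -/
def withVirt {n : ℕ} (y : Weyl n) : Fin (n + 1) → Option ℤ :=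
  Fin.snoc (α := fun _ => Option ℤ) (fun i => some (y.1 i)) none

/-- `f(m) = p δ_{m,1} + (1 - p) δ_{m,0}`. -/
def stepWeight (p : ℝ) (m : ℤ) : ℝ := if m = 1 then p else if m = 0 then 1 - p else 0

/-- The product
`det[Ψ̃_j^N(x_i^N)] ∏_{n=2}^N det[φ(x_i^n, y_j^n)] det[f(x_j^{n-1} - y_i^n)]`, for `N = M + 1`.
The index `k` in the product is `n - 2`. -/
def determinantalWeight (p : ℝ) (M : ℕ) (s : Config M) : ℂ :=
  (Matrix.of fun i j : Fin (M + 1) =>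
      psiTilde p (M + 1) ((j : ℕ) + 1) ((s.x (Fin.last M)).1 i)).det *
    ∏ k : Fin M,
      (((Matrix.of fun i j : Fin (k + 2) =>
            phi ((s.x k.succ).1 i) (withVirt (s.y k) j)).det *
        (Matrix.of fun i j : Fin (k + 1) =>
            stepWeight p ((s.x k.castSucc).1 j - (s.y k).1 i)).det : ℝ) : ℂ)

end AztecChain

end

/-!
The law of the chain at time `N = M + 1` and the law of the lines of a random tiling are both computed
explicitly: each is the product weight `pathWeight`, in which the particles `y` of a level step to the
particles `x` of the same level, each jumping with probability `p`, consecutive levels interlace, and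
the packed vector takes the place of the missing `y` of the top level (`completeY`).

*The chain.*  Since particles move by at most one, `det [P(x_i, y_j)]` is the product of its diagonal
entries (`det_stepMatrix`), and the Vandermonde factors cancel in the transition probability
(`transition_eq`).  The intertwining relation `P Λ = Λ P` (`tsum_interlaces_mul_levelWeight`) holds
because both sides are products of one-coordinate sums.  By induction on the time, the law is a product
weight in which level `k` uses its own jump probability, which vanishes until the level starts to move:
the sum over the old `y`-particles cancels the denominators (`tsum_pathWeight_mul_transition`), and the
old top level is still packed.  The total mass stays `1`, as summing a product weight over its
`x`-particles gives what its predecessor gives when summed over its `y`-particles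
(`hasSum_pathWeight`).

*The determinants.*  `det φ` is the indicator of interlacing (`det_phi`), `det f` is the weight of a
step, and the residue calculus writes `Ψ̃_j` as a unitriangular combination of step weights from the
packed configuration (`det_psiTilde`).  So the product of determinants is the product weight, up to the
sign of the permutation that reverses the order of the particles.

*The tilings.*  Give the square `(c, r)` the line-time `c - r + N` and the height `r`.  A domino then
joins a square at an odd line-time to one at a neighbouring even line-time, and a tiling is a solution of
the local rules `IsFlow`, which say that every square is covered once.  Summed along a line-time, the
rules express the East and West indicators through the counting functions of the particles
(`IsFlow.e_eq_cnt`, `IsFlow.w_eq_cnt`).  That these are `0` or `1` is the step condition and the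
interlacing condition, so tilings correspond bijectively to the configurations of nonzero product
weight.  East dominoes are the jumps, and there are as many West dominoes as East dominoes
(`verticalCount_eq`), so that the weight `a^{v(T)}` is proportional to the product weight.  The constant
of proportionality, the partition function, comes from the total mass of the chain
(`sum_pow_verticalCount`).
-/

namespace AztecChain

/-! ### Transition weights of a single level -/

/-- The weight `∏ P(x_i, y_i)` of moving from `x` to `y` with every particle keeping its label.
It is the value of the determinant `det [P(x_i, y_j)]`. -/
noncomputable def levelWeight {n : ℕ} (p : ℝ) (x y : Weyl n) : ℝ :=
  ∏ i, stepMatrix p (x.1 i) (y.1 i)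

theorem stepMatrix_nonneg {p : ℝ} (h0 : 0 ≤ p) (h1 : p ≤ 1) (x y : ℤ) : 0 ≤ stepMatrix p x y := by
  unfold stepMatrix
  split_ifs <;> linarith

theorem eq_or_eq_of_stepMatrix_ne_zero {p : ℝ} {x y : ℤ} (h : stepMatrix p x y ≠ 0) :
    y = x + 1 ∨ y = x := by
  unfold stepMatrix at h
  split_ifs at h <;> tauto

theorem levelWeight_nonneg {n : ℕ} {p : ℝ} (h0 : 0 ≤ p) (h1 : p ≤ 1) (x y : Weyl n) :
    0 ≤ levelWeight p x y :=
  Finset.prod_nonneg fun _ _ => stepMatrix_nonneg h0 h1 _ _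

/-- In the Leibniz expansion only the identity survives: a particle cannot overtake another one in a
single step. -/
theorem det_stepMatrix {n : ℕ} (p : ℝ) (x y : Weyl n) :
    (Matrix.of fun i j : Fin n => stepMatrix p (x.1 i) (y.1 j)).det = levelWeight p x y := by
  rw [← Matrix.det_transpose, Matrix.det_apply]
  rw [Finset.sum_eq_single (1 : Equiv.Perm (Fin n))]
  · simp [levelWeight, Matrix.transpose_apply]
  · intro σ _ hσ
    suffices h : ∃ i, stepMatrix p (x.1 i) (y.1 (σ i)) = 0 by
      obtain ⟨i, hi⟩ := h
      rw [Finset.prod_eq_zero (Finset.mem_univ i) (by simpa using hi), smul_zero]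
    by_contra! hne
    apply hσ
    have hmono : StrictMono σ := by
      intro i j hij
      by_contra! hle
      have h1 := eq_or_eq_of_stepMatrix_ne_zero (hne i)
      have h2 := eq_or_eq_of_stepMatrix_ne_zero (hne j)
      have h3 := x.2 hij
      have h4 := y.2 (lt_of_le_of_ne hle fun h => hij.ne' (σ.injective h))
      omega
    ext i
    have := Subsingleton.elim (hmono.orderIsoOfSurjective σ σ.surjective) (OrderIso.refl (Fin n))
    simpa using congrArg Fin.val (DFunLike.congr_fun this i)
  · simp

theorem levelWeight_zero {n : ℕ} (x y : Weyl n) [Decidable (y = x)] :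
    levelWeight 0 x y = if y = x then 1 else 0 := by
  split_ifs with h
  · subst h
    simp [levelWeight, stepMatrix]
  · obtain ⟨i, hi⟩ : ∃ i, y.1 i ≠ x.1 i := by
      by_contra! hc
      exact h (Subtype.ext (funext hc))
    refine Finset.prod_eq_zero (Finset.mem_univ i) ?_
    simp [stepMatrix, hi]

theorem vandermonde_pos {n : ℕ} (x : Weyl n) : 0 < vandermonde x := by
  refine Finset.prod_pos fun i _ => Finset.prod_pos fun j hj => ?_
  have := x.2 (Finset.mem_Ioi.1 hj)
  exact sub_pos.2 (by exact_mod_cast this)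

theorem levelTransition_eq {n : ℕ} (p : ℝ) (x y : Weyl n) :
    levelTransition p x y = vandermonde y / vandermonde x * levelWeight p x y := by
  rw [levelTransition, det_stepMatrix]

/-! ### Sums of products over finitely supported families -/

theorem hasSum_pi_prod {ι : Type*} [Fintype ι] [DecidableEq ι] {β : ι → Type*}
    (h : ∀ k, β k → ℝ) (hfin : ∀ k, (Function.support (h k)).Finite) :
    HasSum (fun y : ∀ k, β k => ∏ k, h k (y k)) (∏ k, ∑' u, h k u) := by
  have hs : ∀ k, ∑' u, h k u = ∑ u ∈ (hfin k).toFinset, h k u := fun k =>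
    tsum_eq_sum fun u hu => by simpa using hu
  simp only [hs, Finset.prod_univ_sum]
  refine hasSum_sum_of_ne_finset_zero fun y hy => ?_
  simp only [Fintype.mem_piFinset, not_forall] at hy
  obtain ⟨k, hk⟩ := hy
  exact Finset.prod_eq_zero (Finset.mem_univ k) (by simpa using hk)

/-- A sum over the Weyl chamber factorizes when the summand is a product that forces its argument to
be strictly increasing. -/
theorem tsum_weyl_prod {n : ℕ} (f : Fin n → ℤ → ℝ) (s : Fin n → Finset ℤ)
    (hs : ∀ i u, u ∉ s i → f i u = 0)
    (hf : ∀ z : Fin n → ℤ, (∀ i, f i (z i) ≠ 0) → StrictMono z) :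
    ∑' z : Weyl n, ∏ i, f i (z.1 i) = ∏ i, ∑ u ∈ s i, f i u := by
  have h1 := tsum_subtype_eq_of_support_subset (f := fun z : Fin n → ℤ => ∏ i, f i (z i))
    (s := {z | StrictMono z}) (fun z hz => hf z fun i => Finset.prod_ne_zero_iff.1 hz i (by simp))
  refine h1.trans ?_
  rw [(hasSum_pi_prod f fun i => (s i).finite_toSet.subset fun u hu => ?_).tsum_eq]
  · exact Finset.prod_congr rfl fun i _ => tsum_eq_sum fun u hu => hs i u hu
  · by_contra hc
    exact hu (hs i u hc)

theorem finite_weyl_Icc {n : ℕ} (l u : Fin n → ℤ) :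
    {z : Weyl n | ∀ i, l i ≤ z.1 i ∧ z.1 i ≤ u i}.Finite := by
  refine ((Set.finite_Icc l u).preimage Subtype.val_injective.injOn).subset fun z hz => ?_
  exact ⟨fun i => (hz i).1, fun i => (hz i).2⟩

/-! ### The intertwining relation -/

open Classical in
/-- The link-after-step weight without Vandermonde factors, `∑_z T(x,z) 1_{y ≺ z}`. -/
noncomputable def linkWeight {n : ℕ} (p : ℝ) (x : Weyl (n + 1)) (y : Weyl n) : ℝ :=
  ∑' z : Weyl (n + 1), levelWeight p x z * if Interlaces y z then 1 else 0

theorem finite_support_levelWeight {n : ℕ} (p : ℝ) (x : Weyl n) :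
    {z | levelWeight p x z ≠ 0}.Finite := by
  refine (finite_weyl_Icc x.1 (fun i => x.1 i + 1)).subset fun z hz i => ?_
  have := eq_or_eq_of_stepMatrix_ne_zero (Finset.prod_ne_zero_iff.1 hz i (by simp))
  omega

theorem finite_support_levelWeight_left {n : ℕ} (p : ℝ) (y : Weyl n) :
    {z | levelWeight p z y ≠ 0}.Finite := by
  refine (finite_weyl_Icc (fun i => y.1 i - 1) y.1).subset fun z hz i => ?_
  have := eq_or_eq_of_stepMatrix_ne_zero (Finset.prod_ne_zero_iff.1 hz i (by simp))
  omega

theorem linkStep_eq {n : ℕ} (p : ℝ) (x : Weyl (n + 1)) (y : Weyl n) :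
    linkStep p x y = (n.factorial * (vandermonde y / vandermonde x)) * linkWeight p x y := by
  rw [linkStep, linkWeight, ← tsum_mul_left]
  refine tsum_congr fun z => ?_
  have h1 := (vandermonde_pos x).ne'
  have h2 := (vandermonde_pos z).ne'
  rw [levelTransition_eq, link]
  field_simp

theorem linkStep_factor_pos {n : ℕ} (x : Weyl (n + 1)) (y : Weyl n) :
    0 < (n.factorial * (vandermonde y / vandermonde x) : ℝ) :=
  mul_pos (by positivity) (div_pos (vandermonde_pos y) (vandermonde_pos x))

theorem levelTransition_mul_link_div {n : ℕ} (p : ℝ) (x z : Weyl (n + 1)) (y : Weyl n)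
    [Decidable (Interlaces y z)] :
    levelTransition p x z * link z y / linkStep p x y =
      levelWeight p x z * (if Interlaces y z then 1 else 0) / linkWeight p x y := by
  have h1 := (vandermonde_pos x).ne'
  have h2 := (vandermonde_pos z).ne'
  have h3 := (vandermonde_pos y).ne'
  have h4 : (n.factorial : ℝ) ≠ 0 := by positivity
  have h5 : levelTransition p x z * link z y = (n.factorial * (vandermonde y / vandermonde x)) *
      (levelWeight p x z * (if Interlaces y z then 1 else 0)) := by
    rw [levelTransition_eq, link]
    field_simp
    congr
  rw [linkStep_eq, h5, mul_div_mul_left _ _ (linkStep_factor_pos x y).ne']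

/-- The contribution to the intertwining product of `y` and the particle `x` below it, `x < y`. -/
noncomputable def lowerFactor (p : ℝ) (x y : ℤ) : ℝ :=
  if y ≤ x then 0 else if y = x + 1 then 1 - p else 1

/-- The contribution to the intertwining product of `y` and the particle `x` above it, which is
`y ≤ x`, or `y = x + 1` if `x` is pushed. -/
noncomputable def upperFactor (p : ℝ) (x y : ℤ) : ℝ :=
  if y ≤ x then 1 else if y = x + 1 then p else 0

/-- Each coordinate of `z` is constrained separately, by its neighbours in `y` only. -/
theorem linkWeight_eq_prod {n : ℕ} (p : ℝ) (x : Weyl (n + 1)) (y : Weyl n) :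
    linkWeight p x y =
      ∏ i : Fin n, lowerFactor p (x.1 i.castSucc) (y.1 i) * upperFactor p (x.1 i.succ) (y.1 i) := by
  classical
  -- The bounds `x 0 - 1` and `x n + 2` stand for the missing neighbours; a step never violates them.
  set lo : Fin (n + 1) → ℤ := Fin.cons (x.1 0 - 1) y.1 with hlo
  set hi : Fin (n + 1) → ℤ := Fin.snoc (α := fun _ => ℤ) y.1 (x.1 (Fin.last n) + 2) with hhi
  set f : Fin (n + 1) → ℤ → ℝ := fun j u =>
    stepMatrix p (x.1 j) u * if lo j ≤ u ∧ u < hi j then 1 else 0 with hf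
  have hlosucc : ∀ i : Fin n, lo i.succ = y.1 i := fun i => by simp [hlo]
  have hhicast : ∀ i : Fin n, hi i.castSucc = y.1 i := fun i => by simp [hhi]
  have hlo0 : lo 0 = x.1 0 - 1 := by simp [hlo]
  have hhil : hi (Fin.last n) = x.1 (Fin.last n) + 2 := by simp [hhi]
  have hterm : ∀ z : Weyl (n + 1),
      (levelWeight p x z * if Interlaces y z then (1 : ℝ) else 0) = ∏ j, f j (z.1 j) := by
    intro z
    rw [Finset.prod_mul_distrib, ← levelWeight]
    by_cases h0 : levelWeight p x z = 0
    · simp [h0]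
    congr 1
    rw [Finset.prod_ite_zero]
    have hst := fun j => eq_or_eq_of_stepMatrix_ne_zero (Finset.prod_ne_zero_iff.1 h0 j (by simp))
    have : Interlaces y z ↔ ∀ j ∈ Finset.univ, lo j ≤ z.1 j ∧ z.1 j < hi j := by
      constructor
      · intro h j _
        constructor
        · induction j using Fin.cases with
          | zero => rw [hlo0]; have := hst 0; omega
          | succ i => rw [hlosucc]; exact (h i).2
        · induction j using Fin.lastCases with
          | last => rw [hhil]; have := hst (Fin.last n); omega
          | cast i => rw [hhicast]; exact (h i).1
      · intro h i
        have h1 := (h i.castSucc (by simp)).2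
        have h2 := (h i.succ (by simp)).1
        rw [hhicast] at h1
        rw [hlosucc] at h2
        exact ⟨h1, h2⟩
    simp [this]
  rw [linkWeight]
  have hsum := tsum_weyl_prod f (fun j => {x.1 j, x.1 j + 1}) (fun j u hu => by
      have : stepMatrix p (x.1 j) u = 0 := by
        simp only [Finset.mem_insert, Finset.mem_singleton, not_or] at hu
        simp [stepMatrix, hu.1, hu.2]
      simp [hf, this]) (fun z hz => by
      refine Fin.strictMono_iff_lt_succ.2 fun i => ?_
      have h1 := hz i.castSucc
      have h2 := hz i.succ
      simp only [hf, ne_eq, mul_eq_zero, not_or, ite_eq_right_iff, one_ne_zero, imp_false,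
        not_not, hhicast, hlosucc] at h1 h2
      exact h1.2.2.trans_le h2.2.1)
  rw [tsum_congr hterm, hsum]
  have hfac : ∀ j, ∑ u ∈ {x.1 j, x.1 j + 1}, f j u =
      lowerFactor p (x.1 j) (hi j) * upperFactor p (x.1 j) (lo j) := by
    intro j
    have hne : ¬ (lo j = x.1 j + 1 ∧ hi j = x.1 j + 1) := by
      rintro ⟨h1, h2⟩
      induction j using Fin.cases with
      | zero => omega
      | succ i =>
        rcases Fin.eq_castSucc_or_eq_last i.succ with ⟨j, hj⟩ | hj
        · rw [hj, hhicast, ← hj] at h2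
          rw [hlosucc] at h1
          have h3 := y.2.injective (h1.trans h2.symm)
          subst h3
          exact Fin.castSucc_lt_succ.ne' hj
        · rw [hj, hhil] at h2
          omega
    rw [Finset.sum_pair (by omega)]
    simp only [hf, stepMatrix, lowerFactor, upperFactor]
    split_ifs <;> first | omega | ring
  simp only [hfac, Finset.prod_mul_distrib]
  congr 1
  · rw [Fin.prod_univ_castSucc]
    simp [hhicast, hhil, lowerFactor]
  · rw [Fin.prod_univ_succ]
    simp [hlosucc, hlo0, upperFactor]

open Classical in
/-- The intertwining relation `P Λ = Λ P`, without Vandermonde factors. -/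
theorem tsum_interlaces_mul_levelWeight {n : ℕ} (p : ℝ) (x : Weyl (n + 1)) (y : Weyl n) :
    ∑' w : Weyl n, (if Interlaces w x then 1 else 0) * levelWeight p w y = linkWeight p x y := by
  rw [linkWeight_eq_prod]
  have hterm : ∀ w : Weyl n, (if Interlaces w x then (1 : ℝ) else 0) * levelWeight p w y =
      ∏ i, ((if x.1 i.castSucc < w.1 i ∧ w.1 i ≤ x.1 i.succ then 1 else 0) *
        stepMatrix p (w.1 i) (y.1 i)) := by
    intro w
    rw [Finset.prod_mul_distrib, ← levelWeight, Finset.prod_ite_zero]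
    by_cases h : Interlaces w x
    · rw [if_pos h, if_pos fun i _ => h i, Finset.prod_const_one]
    · rw [if_neg h, if_neg fun h' => h fun i => h' i (Finset.mem_univ i)]
  rw [tsum_congr hterm, tsum_weyl_prod (fun i u => (if x.1 i.castSucc < u ∧ u ≤ x.1 i.succ
    then (1 : ℝ) else 0) * stepMatrix p u (y.1 i)) (fun i => {y.1 i - 1, y.1 i})]
  · refine Finset.prod_congr rfl fun i _ => ?_
    have hx := x.2 (Fin.castSucc_lt_succ (i := i))
    rw [Finset.sum_pair (by omega)]
    simp only [stepMatrix, lowerFactor, upperFactor]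
    split_ifs <;> first | omega | ring
  · intro i u hu
    have : stepMatrix p u (y.1 i) = 0 := by
      simp only [Finset.mem_insert, Finset.mem_singleton, not_or] at hu
      rw [stepMatrix, if_neg (by omega), if_neg (by omega)]
    rw [this, mul_zero]
  · intro z hz i j hij
    have h1 := hz i
    have h2 := hz j
    simp only [ne_eq, mul_eq_zero, not_or, ite_eq_right_iff, one_ne_zero, imp_false,
      not_not] at h1 h2
    have h3 : x.1 i.succ ≤ x.1 j.castSucc := x.2.monotone (by
      rw [Fin.le_def]; simpa using hij)
    omega

theorem linkWeight_pos_of_right {n : ℕ} {p : ℝ} (h0 : 0 ≤ p) (h1 : p ≤ 1) {x z : Weyl (n + 1)}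
    {y : Weyl n} (hyz : Interlaces y z) (h : levelWeight p x z ≠ 0) : 0 < linkWeight p x y := by
  classical
  have hs : Summable fun z : Weyl (n + 1) =>
      levelWeight p x z * if Interlaces y z then (1 : ℝ) else 0 :=
    summable_of_hasFiniteSupport ((finite_support_levelWeight p x).subset fun z hz => by
      simp only [Function.mem_support, ne_eq, mul_eq_zero, not_or] at hz
      exact hz.1)
  refine hs.tsum_pos (fun z => mul_nonneg (levelWeight_nonneg h0 h1 _ _) ?_) z ?_
  · split_ifs <;> norm_num
  · simpa [hyz] using lt_of_le_of_ne (levelWeight_nonneg h0 h1 x z) h.symm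

theorem linkWeight_pos_of_left {n : ℕ} {p : ℝ} (h0 : 0 ≤ p) (h1 : p ≤ 1) {x : Weyl (n + 1)}
    {w y : Weyl n} (hwx : Interlaces w x) (h : levelWeight p w y ≠ 0) : 0 < linkWeight p x y := by
  classical
  rw [← tsum_interlaces_mul_levelWeight]
  have hs : Summable fun w : Weyl n => (if Interlaces w x then (1 : ℝ) else 0) * levelWeight p w y :=
    summable_of_hasFiniteSupport ((finite_support_levelWeight_left p y).subset fun z hz => by
      simp only [Function.mem_support, ne_eq, mul_eq_zero, not_or] at hz
      exact hz.2)
  refine hs.tsum_pos (fun z => mul_nonneg ?_ (levelWeight_nonneg h0 h1 _ _)) w ?_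
  · split_ifs <;> norm_num
  · simpa [hwx] using lt_of_le_of_ne (levelWeight_nonneg h0 h1 w y) h.symm

/-! ### The law of the chain -/

variable {M : ℕ}

/-- The `y`-vectors of a configuration, completed by the packed vector at the top level.  The top level
has been packed up to the last step of the chain, and the lines of a tiling end at these heights. -/
def completeY (y : ∀ k : Fin M, Weyl (k + 1)) : ∀ k : Fin (M + 1), Weyl (k + 1) :=
  Fin.snoc (α := fun k : Fin (M + 1) => Weyl (k + 1)) y (packedVector (M + 1))

@[simp]
theorem completeY_castSucc (y : ∀ k : Fin M, Weyl (k + 1)) (k : Fin M) :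
    completeY y k.castSucc = y k :=
  Fin.snoc_castSucc (α := fun k : Fin (M + 1) => Weyl (k + 1)) _ _ _

@[simp]
theorem completeY_last (y : ∀ k : Fin M, Weyl (k + 1)) :
    completeY y (Fin.last M) = packedVector (M + 1) :=
  Fin.snoc_last (α := fun k : Fin (M + 1) => Weyl (k + 1)) _ _

open Classical in
/-- The product weight of a configuration: particles step from `y` to `x` with jump probability
`q k` on level `k`, and consecutive levels interlace. -/
noncomputable def pathWeight (q : Fin (M + 1) → ℝ) (s : Config M) : ℝ :=
  (∏ k : Fin (M + 1), levelWeight (q k) (completeY s.y k) (s.x k)) *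
    ∏ k : Fin M, if Interlaces (s.y k) (s.x k.succ) then 1 else 0

theorem pathWeight_nonneg {q : Fin (M + 1) → ℝ} (h0 : ∀ k, 0 ≤ q k) (h1 : ∀ k, q k ≤ 1)
    (s : Config M) : 0 ≤ pathWeight q s := by
  refine mul_nonneg (Finset.prod_nonneg fun k _ => levelWeight_nonneg (h0 k) (h1 k) _ _)
    (Finset.prod_nonneg fun k _ => ?_)
  split_ifs <;> norm_num

theorem pathWeight_ne_zero_iff {q : Fin (M + 1) → ℝ} {s : Config M} :
    pathWeight q s ≠ 0 ↔ (∀ k, levelWeight (q k) (completeY s.y k) (s.x k) ≠ 0) ∧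
      ∀ k : Fin M, Interlaces (s.y k) (s.x k.succ) := by
  simp [pathWeight, Finset.prod_eq_zero_iff]

/-- A configuration is a pair of a family of `x`-vectors and a family of `y`-vectors. -/
def configEquiv (M : ℕ) :
    (∀ k : Fin (M + 1), Weyl (k + 1)) × (∀ k : Fin M, Weyl (k + 1)) ≃ Config M where
  toFun z := ⟨z.1, z.2⟩
  invFun s := (s.x, s.y)
  left_inv _ := rfl
  right_inv _ := rfl

theorem hasSum_pathWeight_y (q : Fin (M + 1) → ℝ) (x : ∀ k : Fin (M + 1), Weyl (k + 1)) :
    HasSum (fun y => pathWeight q ⟨x, y⟩)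
      (levelWeight (q (Fin.last M)) (packedVector (M + 1)) (x (Fin.last M)) *
        ∏ k : Fin M, linkWeight (q k.castSucc) (x k.succ) (x k.castSucc)) := by
  classical
  have hterm : ∀ y, pathWeight q ⟨x, y⟩ =
      levelWeight (q (Fin.last M)) (packedVector (M + 1)) (x (Fin.last M)) *
        ∏ k : Fin M, (if Interlaces (y k) (x k.succ) then 1 else 0) *
          levelWeight (q k.castSucc) (y k) (x k.castSucc) := by
    intro y
    rw [pathWeight, Fin.prod_univ_castSucc, Finset.prod_mul_distrib]
    simp only [completeY_castSucc, completeY_last, Fin.val_last, Fin.val_castSucc]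
    ring
  simp only [hterm]
  refine HasSum.mul_left _ ?_
  have h := hasSum_pi_prod (fun (k : Fin M) (w : Weyl (k + 1)) =>
    (if Interlaces w (x k.succ) then (1 : ℝ) else 0) *
      levelWeight (q k.castSucc) w (x k.castSucc)) fun k =>
        (finite_support_levelWeight_left (q k.castSucc) (x k.castSucc)).subset fun w hw => by
          simp only [Function.mem_support, ne_eq, mul_eq_zero, not_or] at hw
          exact hw.2
  rwa [Finset.prod_congr rfl fun k _ => tsum_interlaces_mul_levelWeight (q k.castSucc) (x k.succ)
    (x k.castSucc)] at h

theorem tsum_levelWeight_one {n : ℕ} (hn : n = 1) (p : ℝ) (x : Weyl n) :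
    ∑' u : Weyl n, levelWeight p x u = 1 := by
  subst hn
  refine (tsum_weyl_prod (fun i u => stepMatrix p (x.1 i) u) (fun i => {x.1 i, x.1 i + 1})
    (fun i u hu => ?_) (fun z _ => Subsingleton.strictMono z)).trans ?_
  · simp only [Finset.mem_insert, Finset.mem_singleton, not_or] at hu
    simp [stepMatrix, hu.1, hu.2]
  · refine Finset.prod_eq_one fun i _ => ?_
    rw [Finset.sum_pair (by omega)]
    simp [stepMatrix]

theorem hasSum_pathWeight_x (q : Fin (M + 1) → ℝ) (y : ∀ k : Fin M, Weyl (k + 1)) :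
    HasSum (fun x => pathWeight q ⟨x, y⟩)
      (∏ k : Fin M, linkWeight (q k.succ) (completeY y k.succ) (y k)) := by
  classical
  set h : ∀ k : Fin (M + 1), Weyl (k + 1) → ℝ :=
    Fin.cases (motive := fun k => Weyl (k + 1) → ℝ) (fun u => levelWeight (q 0) (completeY y 0) u)
      (fun k u => levelWeight (q k.succ) (completeY y k.succ) u *
        if Interlaces (y k) u then 1 else 0) with hh
  have hterm : ∀ x, pathWeight q ⟨x, y⟩ = ∏ k, h k (x k) := by
    intro x
    rw [pathWeight, Fin.prod_univ_succ, Fin.prod_univ_succ, mul_assoc, ← Finset.prod_mul_distrib]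
    rfl
  have hfin : ∀ k, (Function.support (h k)).Finite := by
    intro k
    refine (finite_support_levelWeight (q k) (completeY y k)).subset fun u hu => ?_
    induction k using Fin.cases with
    | zero => exact hu
    | succ k => exact left_ne_zero_of_mul hu
  simp only [hterm]
  convert hasSum_pi_prod h hfin using 1
  rw [Fin.prod_univ_succ]
  have h0 : ∑' u, h 0 u = 1 := tsum_levelWeight_one rfl _ _
  rw [h0, one_mul]
  rfl

/-- The one-step transition without Vandermonde factors: these cancel. -/
theorem transition_eq (a : ℝ) (t : ℕ) (s s' : Config M)
    [Decidable (∀ k : Fin M, s'.y k = s.x k.castSucc)]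
    [∀ k : Fin M, Decidable (Interlaces (s.x k.castSucc) (s'.x k.succ))] :
    transition a M t s s' = (if ∀ k : Fin M, s'.y k = s.x k.castSucc then 1 else 0) *
      (levelWeight (jumpProbAt a t) (s.x 0) (s'.x 0) * ∏ k : Fin M,
        levelWeight (jumpProbAt a ((t : ℤ) - k - 1)) (s.x k.succ) (s'.x k.succ) *
          (if Interlaces (s.x k.castSucc) (s'.x k.succ) then 1 else 0) /
            linkWeight (jumpProbAt a ((t : ℤ) - k - 1)) (s.x k.succ) (s.x k.castSucc)) := by
  have hv : ∀ {n : ℕ} (_ : n = 1) (x : Weyl n), vandermonde x = 1 := by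
    rintro n rfl x
    simp [vandermonde]
  have h1 : vandermonde (s.x 0) = 1 := hv rfl _
  have h2 : vandermonde (s'.x 0) = 1 := hv rfl _
  rw [transition, levelTransition_eq, h1, h2]
  simp only [div_one, one_mul]
  congr 2
  exact Finset.prod_congr rfl fun k _ => levelTransition_mul_link_div _ _ _ _

theorem completeY_injective : Function.Injective (completeY (M := M)) := fun y y' h =>
  funext fun k => by simpa using congrFun h k.castSucc

theorem mem_range_completeY {x : ∀ k : Fin (M + 1), Weyl (k + 1)}
    (hx : x (Fin.last M) = packedVector (M + 1)) :
    x = completeY fun k : Fin M => x k.castSucc := by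
  funext k
  induction k using Fin.lastCases with
  | last => simpa using hx
  | cast k => simp

/-- One step of the chain maps a product weight to the product weight with every level delayed by one
time unit.  The sum over the old `y`-particles cancels the denominators, by intertwining. -/
theorem tsum_pathWeight_mul_transition (a : ℝ) (t : ℕ) {q q' : Fin (M + 1) → ℝ}
    (hq : ∀ k, q k = jumpProbAt a ((t : ℤ) - k)) (hq' : ∀ k : Fin M, q' k.castSucc = q k.succ)
    (hlast : q' (Fin.last M) = 0) (h0 : ∀ k, 0 ≤ q k) (h1 : ∀ k, q k ≤ 1) (s' : Config M) :
    ∑' s : Config M, pathWeight q' s * transition a M t s s' = pathWeight q s' := by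
  classical
  have hinj : Function.Injective fun w => (⟨completeY s'.y, w⟩ : Config M) :=
    fun w w' h => congrArg Config.y h
  have hsupp : Function.support (fun s : Config M => pathWeight q' s * transition a M t s s') ⊆
      Set.range fun w => (⟨completeY s'.y, w⟩ : Config M) := by
    rintro ⟨x, w⟩ hs
    have hs1 := (pathWeight_ne_zero_iff.1 (left_ne_zero_of_mul hs)).1 (Fin.last M)
    have hs2 := right_ne_zero_of_mul hs
    rw [transition_eq] at hs2
    have hs3 := left_ne_zero_of_mul hs2
    simp only [ne_eq, ite_eq_right_iff, one_ne_zero, imp_false, not_not] at hs3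
    rw [hlast, levelWeight_zero] at hs1
    simp only [ne_eq, ite_eq_right_iff, one_ne_zero, imp_false, not_not, completeY_last] at hs1
    refine ⟨w, ?_⟩
    have : s'.y = fun k : Fin M => x k.castSucc := funext hs3
    simp only [this]
    rw [← mem_range_completeY hs1]
  rw [← hinj.tsum_eq hsupp]
  simp only [transition_eq, completeY_castSucc, implies_true, if_true, one_mul]
  rw [tsum_mul_right, (hasSum_pathWeight_y q' (completeY s'.y)).tsum_eq, hlast, levelWeight_zero,
    if_pos (by simp), one_mul, mul_left_comm, ← Finset.prod_mul_distrib, pathWeight,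
    Fin.prod_univ_succ, mul_assoc, ← Finset.prod_mul_distrib]
  congr 1
  · simp [hq]
  refine Finset.prod_congr rfl fun k _ => ?_
  have hk : jumpProbAt a ((t : ℤ) - k - 1) = q k.succ := by
    rw [hq]
    congr 1
    push_cast [Fin.val_succ]
    ring
  rw [hk, hq', completeY_castSucc]
  by_cases hz : linkWeight (q k.succ) (completeY s'.y k.succ) (s'.y k) ≠ 0
  · exact mul_div_cancel₀ _ hz
  rw [not_not] at hz
  rw [hz, zero_mul]
  by_contra hne
  replace hne := Ne.symm hne
  have hne2 := right_ne_zero_of_mul hne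
  simp only [ne_eq, ite_eq_right_iff, one_ne_zero, imp_false, not_not] at hne2
  exact (linkWeight_pos_of_right (h0 _) (h1 _) hne2 (left_ne_zero_of_mul hne)).ne' hz

theorem interlaces_packedVector_iff {n : ℕ} {y : Weyl n} :
    Interlaces y (packedVector (n + 1)) ↔ y = packedVector n := by
  constructor
  · intro h
    refine Subtype.ext (funext fun i => ?_)
    have := h i
    simp only [packedVector, Fin.val_castSucc, Fin.val_succ] at this ⊢
    push_cast at this
    omega
  · rintro rfl i
    simp only [packedVector, Fin.val_castSucc, Fin.val_succ]
    push_cast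
    omega

theorem pathWeight_zero (s : Config M) [Decidable (s = packed M)] :
    pathWeight 0 s = if s = packed M then 1 else 0 := by
  classical
  have hpk : completeY (packed M).y = (packed M).x :=
    (mem_range_completeY (x := (packed M).x) rfl).symm
  split_ifs with h
  · subst h
    rw [pathWeight, hpk]
    simp only [Pi.zero_apply, levelWeight_zero, if_true, Finset.prod_const_one, one_mul]
    exact Finset.prod_eq_one fun k _ => if_pos (interlaces_packedVector_iff.2 rfl)
  · by_contra hne
    obtain ⟨h1, h2⟩ := pathWeight_ne_zero_iff.1 hne
    simp only [Pi.zero_apply, levelWeight_zero, ne_eq, ite_eq_right_iff, one_ne_zero, imp_false,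
      not_not] at h1
    have hx : ∀ k, s.x k = packedVector (k + 1) := by
      intro k
      induction k using Fin.reverseInduction with
      | last => rw [h1, completeY_last]; rfl
      | cast k ih =>
        rw [h1, completeY_castSucc]
        have := h2 k
        rw [ih] at this
        exact interlaces_packedVector_iff.1 this
    refine h ?_
    obtain ⟨x, y⟩ := s
    have hx' : x = (packed M).x := funext hx
    have hy : y = (packed M).y := funext fun k => by
      have := h1 k.castSucc
      rw [completeY_castSucc] at this
      exact this.symm.trans (hx k.castSucc)
    rw [hx', hy]

theorem jumpProb_nonneg (a : ℝ) : 0 ≤ jumpProb a := by unfold jumpProb; positivity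

theorem jumpProb_le_one (a : ℝ) : jumpProb a ≤ 1 := by
  unfold jumpProb
  rw [div_le_one (by positivity)]
  linarith

theorem jumpProbAt_nonneg (a : ℝ) (τ : ℤ) : 0 ≤ jumpProbAt a τ := by
  unfold jumpProbAt
  split_ifs
  exacts [jumpProb_nonneg a, le_rfl]

theorem jumpProbAt_le_one (a : ℝ) (τ : ℤ) : jumpProbAt a τ ≤ 1 := by
  unfold jumpProbAt
  split_ifs
  exacts [jumpProb_le_one a, zero_le_one]

/-- The jump probabilities, level by level, of the product weight that is the law at time `t`. -/
noncomputable def delayedProb (a : ℝ) (M t : ℕ) (k : Fin (M + 1)) : ℝ :=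
  jumpProbAt a ((t : ℤ) - 1 - k)

theorem delayedProb_succ (a : ℝ) (t : ℕ) (k : Fin (M + 1)) :
    delayedProb a M (t + 1) k = jumpProbAt a ((t : ℤ) - k) := by
  unfold delayedProb
  congr 1
  push_cast
  ring

theorem delayedProb_castSucc (a : ℝ) (t : ℕ) (k : Fin M) :
    delayedProb a M t k.castSucc = delayedProb a M (t + 1) k.succ := by
  unfold delayedProb
  congr 1
  push_cast [Fin.val_succ, Fin.val_castSucc]
  ring

theorem delayedProb_last (a : ℝ) {t : ℕ} (ht : t ≤ M) : delayedProb a M t (Fin.last M) = 0 := by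
  unfold delayedProb jumpProbAt
  rw [if_neg]
  rw [Fin.val_last]
  omega

theorem delayedProb_zero (a : ℝ) : delayedProb a M 0 = 0 := by
  funext k
  unfold delayedProb jumpProbAt
  rw [if_neg]
  · rfl
  · push_cast
    omega

/-- Until time `N` the law of the chain is a product weight. -/
theorem chainLaw_eq_pathWeight (a : ℝ) (t : ℕ) (ht : t ≤ M + 1) (s : Config M) :
    chainLaw a M t s = pathWeight (delayedProb a M t) s := by
  classical
  induction t generalizing s with
  | zero => rw [delayedProb_zero, pathWeight_zero, chainLaw]
  | succ t ih =>
    rw [chainLaw, ← tsum_pathWeight_mul_transition a t (q' := delayedProb a M t)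
      (delayedProb_succ a t) (delayedProb_castSucc a t) (delayedProb_last a (by omega))
      (fun k => jumpProbAt_nonneg _ _) (fun k => jumpProbAt_le_one _ _)]
    exact tsum_congr fun s => by rw [ih (by omega)]

/-- The total mass is preserved: summing out the `x`-particles at time `t + 1` gives the same as
summing out the `y`-particles at time `t`. -/
theorem hasSum_pathWeight (a : ℝ) (t : ℕ) (ht : t ≤ M + 1) :
    HasSum (pathWeight (delayedProb a M t)) 1 := by
  classical
  induction t with
  | zero =>
    rw [delayedProb_zero]
    have : pathWeight (0 : Fin (M + 1) → ℝ) = fun s => if s = packed M then 1 else 0 :=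
      funext fun s => pathWeight_zero s
    rw [this]
    exact hasSum_ite_eq (packed M) 1
  | succ t ih =>
    set q := delayedProb a M (t + 1) with hq
    have hY : HasSum (fun y => ∏ k : Fin M, linkWeight (q k.succ) (completeY y k.succ) (y k)) 1 := by
      have h1 := (configEquiv M).hasSum_iff.2 (ih (by omega))
      have h2 := h1.prod_fiberwise (fun x => hasSum_pathWeight_y _ x)
      rw [← completeY_injective.hasSum_iff] at h2
      · convert h2 using 2 with y
        simp only [Function.comp_apply, completeY_last, completeY_castSucc,
          delayedProb_last a (show t ≤ M by omega), levelWeight_zero, if_true, one_mul,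
          delayedProb_castSucc, hq]
      · intro x hx
        rw [delayedProb_last a (by omega), levelWeight_zero, if_neg, zero_mul]
        exact fun h => hx ⟨_, (mem_range_completeY h).symm⟩
    have hsum : Summable fun z : (∀ k : Fin M, Weyl (k + 1)) × (∀ k : Fin (M + 1), Weyl (k + 1)) =>
        pathWeight q ⟨z.2, z.1⟩ := by
      have hnn : ∀ s, 0 ≤ pathWeight q s := pathWeight_nonneg (fun k => jumpProbAt_nonneg _ _)
        (fun k => jumpProbAt_le_one _ _)
      refine (summable_prod_of_nonneg fun z => hnn _).2
        ⟨fun y => (hasSum_pathWeight_x q y).summable, ?_⟩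
      simp only [(hasSum_pathWeight_x q _).tsum_eq]
      exact hY.summable
    have h3 := hsum.hasSum.prod_fiberwise (fun y => hasSum_pathWeight_x q y)
    have h4 := hsum.hasSum
    rw [h3.unique hY] at h4
    exact ((Equiv.prodComm _ _).trans (configEquiv M)).hasSum_iff.1 h4

/-- At time `N` every level jumps with probability `p`. -/
theorem chainLaw_final (a : ℝ) (s : Config M) :
    chainLaw a M (M + 1) s = pathWeight (fun _ => jumpProb a) s := by
  rw [chainLaw_eq_pathWeight a _ le_rfl]
  congr 1
  funext k
  rw [delayedProb_succ, jumpProbAt, if_pos (by have := k.is_lt; omega)]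

theorem hasSum_pathWeight_jumpProb (a : ℝ) :
    HasSum (pathWeight (M := M) fun _ => jumpProb a) 1 := by
  have h : pathWeight (delayedProb a M (M + 1)) = pathWeight fun _ => jumpProb a :=
    funext fun s => by rw [← chainLaw_eq_pathWeight a _ le_rfl, chainLaw_final]
  exact h ▸ hasSum_pathWeight a _ le_rfl

theorem linkStep_pos_iff {n : ℕ} {p : ℝ} {x : Weyl (n + 1)} {y : Weyl n} :
    0 < linkStep p x y ↔ 0 < linkWeight p x y := by
  rw [linkStep_eq, mul_pos_iff_of_pos_left (linkStep_factor_pos x y)]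

theorem mem_extendedStateSpace_of_pathWeight_ne_zero (a : ℝ) {s : Config M}
    (hs : pathWeight (fun _ => jumpProb a) s ≠ 0) : s ∈ extendedStateSpace a M := by
  obtain ⟨h1, h2⟩ := pathWeight_ne_zero_iff.1 hs
  refine ⟨fun k => ?_, h2, fun k hk => ?_⟩
  · have := h1 k.castSucc
    rw [completeY_castSucc] at this
    exact linkStep_pos_iff.2 (linkWeight_pos_of_left (jumpProb_nonneg a) (jumpProb_le_one a) (h2 k)
      this)
  · have := h1 (Fin.castSucc ⟨k + 1, hk⟩)
    rw [completeY_castSucc] at this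
    exact linkStep_pos_iff.2 (linkWeight_pos_of_right (jumpProb_nonneg a) (jumpProb_le_one a)
      (h2 ⟨k, Nat.lt_of_succ_lt hk⟩) this)

/-! ### The determinants -/

/-- Row `i` is determined by the number of `y_j ≤ x_i`, so that two equal rows appear unless the
vectors interlace, in which case the matrix is unitriangular. -/
theorem det_phi {n : ℕ} (x : Weyl (n + 1)) (y : Weyl n) [Decidable (Interlaces y x)] :
    (Matrix.of fun i j : Fin (n + 1) => phi (x.1 i) (withVirt y j)).det =
      if Interlaces y x then 1 else 0 := by
  have hvirt : ∀ u, phi u (withVirt y (Fin.last n)) = 1 := fun u => by simp [withVirt, phi]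
  have hcast : ∀ u (j : Fin n), phi u (withVirt y j.castSucc) = if u < y.1 j then 1 else 0 :=
    fun u j => by simp [withVirt, phi]
  split_ifs with h
  · rw [Matrix.det_of_isUpperTriangular]
    · refine Finset.prod_eq_one fun i _ => ?_
      induction i using Fin.lastCases with
      | last => exact hvirt _
      | cast i => exact (hcast _ i).trans (if_pos (h i).1)
    · intro i j hij
      have hij' : j < i := hij
      obtain ⟨j, rfl⟩ : ∃ j', j = Fin.castSucc j' := by
        refine (Fin.eq_castSucc_or_eq_last j).resolve_right fun hl => ?_
        subst hl
        exact absurd hij' (not_lt.2 (Fin.le_last i))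
      refine (hcast _ j).trans (if_neg ?_)
      have h1 := (h j).2
      have h2 : x.1 j.succ ≤ x.1 i := x.2.monotone (Fin.castSucc_lt_iff_succ_le.1 hij')
      omega
  · by_contra hdet
    apply h
    have hrow : ∀ i : Fin n, ∃ j : Fin n, x.1 i.castSucc < y.1 j ∧ y.1 j ≤ x.1 i.succ := by
      intro i
      by_contra! hc
      refine hdet (Matrix.det_zero_of_row_eq (i := i.castSucc) (j := i.succ)
        Fin.castSucc_lt_succ.ne (funext fun j => ?_))
      simp only [Matrix.of_apply]
      induction j using Fin.lastCases with
      | last => rw [hvirt, hvirt]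
      | cast j =>
        rw [hcast, hcast]
        have h1 := hc j
        have h2 := x.2 (Fin.castSucc_lt_succ (i := i))
        exact if_congr ⟨fun h => h1 h, fun h => h2.trans h⟩ rfl rfl
    choose g hg using hrow
    have hmono : StrictMono g := by
      intro i i' hii
      have h1 : x.1 i.succ ≤ x.1 i'.castSucc := x.2.monotone (by rw [Fin.le_def]; simpa using hii)
      exact y.2.lt_iff_lt.1 (((hg i).2.trans h1).trans_lt (hg i').1)
    have hid : ∀ i, g i = i := by
      intro i
      have := Subsingleton.elim (hmono.orderIsoOfSurjective g
        (Finite.surjective_of_injective hmono.injective)) (OrderIso.refl (Fin n))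
      simpa using DFunLike.congr_fun this i
    intro i
    have := hg i
    rwa [hid] at this

theorem det_stepWeight {n : ℕ} (p : ℝ) (x y : Weyl n) :
    (Matrix.of fun i j : Fin n => stepWeight p (x.1 j - y.1 i)).det = levelWeight p y x := by
  rw [← det_stepMatrix]
  congr
  ext i j
  simp only [stepWeight, stepMatrix]
  split_ifs <;> first | rfl | omega

theorem circleIntegral_zpow (n : ℤ) :
    (∮ z in C(0, 1), z ^ n) = if n = -1 then 2 * (Real.pi : ℂ) * Complex.I else 0 := by
  split_ifs with h
  · subst h
    simpa using circleIntegral.integral_sub_center_inv (0 : ℂ) (R := 1) one_ne_zero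
  · simpa using circleIntegral.integral_sub_zpow_of_ne h (0 : ℂ) 0 1

theorem circleIntegrable_zpow (n : ℤ) : CircleIntegrable (fun z : ℂ => z ^ n) 0 1 := by
  simpa using (circleIntegrable_sub_zpow_iff (c := (0 : ℂ)) (w := 0) (R := 1) (n := n)).2 (by simp)

/-- Expanding `(1 - z)^{N-j}` by the binomial theorem and taking the residue at `0` turns `Ψ̃_j` into
a combination of one-particle step weights started from `-j, -j - 1, …, -N`. -/
theorem psiTilde_eq (p : ℝ) (N j : ℕ) (x : ℤ) :
    psiTilde p N j x = ∑ m ∈ Finset.range (N - j + 1),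
      ((-1) ^ m * ((N - j).choose m : ℂ)) * (stepMatrix p (-(j : ℤ) - m) x : ℂ) := by
  have hI : (∮ z in C(0, 1), (1 - z) ^ (N - j) * z ^ (x + (j : ℤ) - 1) *
        (1 - (p : ℂ) + (p : ℂ) * z⁻¹)) =
      ∮ z in C(0, 1), ∑ m ∈ Finset.range (N - j + 1), ((-1) ^ m * ((N - j).choose m : ℂ)) *
        ((1 - (p : ℂ)) * z ^ (x + (j : ℤ) - 1 + m) + (p : ℂ) * z ^ (x + (j : ℤ) - 2 + m)) := by
    refine circleIntegral.integral_congr zero_le_one fun z hz => ?_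
    have hz0 : z ≠ 0 := by
      rintro rfl
      simp at hz
    have hb : (1 - z) ^ (N - j) = ∑ m ∈ Finset.range (N - j + 1),
        ((-1) ^ m * ((N - j).choose m : ℂ)) * z ^ m := by
      rw [sub_eq_neg_add, add_pow]
      refine Finset.sum_congr rfl fun m _ => ?_
      rw [neg_pow]
      ring
    simp only [hb, Finset.sum_mul]
    refine Finset.sum_congr rfl fun m _ => ?_
    have h1 : z ^ (x + (j : ℤ) - 1 + m) = z ^ (x + (j : ℤ) - 1) * z ^ m := by
      rw [zpow_add₀ hz0, zpow_natCast]
    have h2 : z ^ (x + (j : ℤ) - 2 + m) = z ^ (x + (j : ℤ) - 1) * z ^ m * z⁻¹ := by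
      rw [← h1, ← zpow_sub_one₀ hz0]
      congr 1
      ring
    rw [h1, h2]
    ring
  have hint : ∀ (c : ℂ) (n : ℤ), CircleIntegrable (fun z : ℂ => c * z ^ n) 0 1 :=
    fun c n => (circleIntegrable_zpow n).const_smul (a := c)
  have hadd : ∀ (b c : ℂ) (k l : ℤ), CircleIntegrable (fun z : ℂ => b * z ^ k + c * z ^ l) 0 1 :=
    fun b c k l => (hint b k).add (hint c l)
  have hpi : (2 * (Real.pi : ℂ) * Complex.I) ≠ 0 := Complex.two_pi_I_ne_zero
  rw [psiTilde, hI, circleIntegral.integral_fun_sum, Finset.mul_sum]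
  · refine Finset.sum_congr rfl fun m _ => ?_
    rw [circleIntegral.integral_const_mul, circleIntegral.integral_add (hint _ _) (hint _ _),
      circleIntegral.integral_const_mul, circleIntegral.integral_const_mul,
      circleIntegral_zpow, circleIntegral_zpow, mul_left_comm]
    congr 1
    rw [inv_mul_eq_iff_eq_mul₀ hpi]
    unfold stepMatrix
    split_ifs <;> first | omega | (push_cast; ring)
  · intro m _
    exact (hadd _ _ _ _).const_smul (a := (-1 : ℂ) ^ m * ((N - j).choose m : ℂ))

/-- The change of basis between the `Ψ̃_j` and the step weights started from the packed
configuration; it is unitriangular. -/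
def binomialMatrix (N : ℕ) : Matrix (Fin N) (Fin N) ℂ :=
  Matrix.of fun i j => if j ≤ i then (-1) ^ (i - j : ℕ) * ((N - (j + 1)).choose (i - j) : ℂ) else 0

theorem det_binomialMatrix (N : ℕ) : (binomialMatrix N).det = 1 := by
  rw [Matrix.det_of_isLowerTriangular]
  · simp [binomialMatrix]
  · intro i j hij
    exact if_neg (not_le.2 hij)

theorem det_psiTilde (p : ℝ) (N : ℕ) (x : Weyl N) :
    (Matrix.of fun i j : Fin N => psiTilde p N ((j : ℕ) + 1) (x.1 i)).det =
      ((Equiv.Perm.sign (Fin.revPerm (n := N)) : ℤ) : ℂ) * (levelWeight p (packedVector N) x : ℂ) := by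
  have hfac : (Matrix.of fun i j : Fin N => psiTilde p N ((j : ℕ) + 1) (x.1 i)) =
      ((Matrix.of fun i j : Fin N => stepMatrix p ((packedVector N).1 i) (x.1 j)).map
        Complex.ofRealHom).transpose.submatrix id Fin.revPerm * binomialMatrix N := by
    ext i j
    have hj : N - ((j : ℕ) + 1) + 1 = N - j := by omega
    simp only [Matrix.of_apply, Matrix.mul_apply, psiTilde_eq, hj]
    have hpk : ∀ l : Fin N, (packedVector N).1 (Fin.revPerm l) = -(l : ℤ) - 1 := by
      intro l
      simp only [packedVector, Fin.revPerm_apply, Fin.val_rev]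
      omega
    simp only [Matrix.submatrix_apply, Matrix.transpose_apply, Matrix.map_apply, Matrix.of_apply,
      hpk, id, binomialMatrix, Fin.le_def]
    rw [← Finset.sum_range (fun l : ℕ => Complex.ofRealHom (stepMatrix p (-(l : ℤ) - 1) (x.1 i)) *
      if (j : ℕ) ≤ l then (-1) ^ (l - j : ℕ) * ((N - (j + 1)).choose (l - j) : ℂ) else 0)]
    simp only [mul_ite, mul_zero]
    rw [← Finset.sum_filter]
    have hIco : (Finset.range N).filter (fun l => (j : ℕ) ≤ l) = Finset.Ico (j : ℕ) N := by
      ext l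
      simp [and_comm]
    rw [hIco, Finset.sum_Ico_eq_sum_range]
    refine Finset.sum_congr rfl fun m _ => ?_
    have h1 : -(((j : ℕ) + 1 : ℕ) : ℤ) - m = -(((j : ℕ) + m : ℕ) : ℤ) - 1 := by push_cast; ring
    rw [h1, Nat.add_sub_cancel_left, mul_comm]
    rfl
  rw [hfac, Matrix.det_mul, det_binomialMatrix, mul_one, Matrix.det_permute', Matrix.det_transpose,
    ← det_stepMatrix]
  congr 1
  exact (RingHom.map_det Complex.ofRealHom _).symm

theorem determinantalWeight_eq (p : ℝ) (M : ℕ) (s : Config M) :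
    determinantalWeight p M s =
      ((Equiv.Perm.sign (Fin.revPerm (n := M + 1)) : ℤ) : ℂ) * (pathWeight (fun _ => p) s : ℂ) := by
  classical
  have h : ∀ k : Fin M, (Matrix.of fun i j : Fin (k + 2) =>
        phi ((s.x k.succ).1 i) (withVirt (s.y k) j)).det =
          if Interlaces (s.y k) (s.x k.succ) then 1 else 0 :=
    fun k => det_phi (n := k + 1) (s.x k.succ) (s.y k)
  have h' : ∀ k : Fin M, (Matrix.of fun i j : Fin (k + 1) =>
        stepWeight p ((s.x k.castSucc).1 j - (s.y k).1 i)).det =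
          levelWeight p (s.y k) (s.x k.castSucc) :=
    fun k => det_stepWeight (n := k + 1) p (s.x k.castSucc) (s.y k)
  rw [determinantalWeight]
  have h0 := det_psiTilde p (M + 1) (s.x (Fin.last M))
  simp only [h, h', Complex.ofReal_mul]
  rw [pathWeight, Fin.prod_univ_castSucc, Finset.prod_mul_distrib]
  simp only [completeY_castSucc, completeY_last, Complex.ofReal_mul, Complex.ofReal_prod]
  refine (congrArg₂ (· * ·) h0 rfl).trans ?_
  simp only [Fin.val_castSucc, Fin.val_last]
  ring

/-! ### Domino tilings as flows -/

theorem mem_aztecSquares {N : ℕ} {c r : ℤ} : (c, r) ∈ aztecSquares N ↔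
    c + r + 1 ≤ N ∧ -(N : ℤ) ≤ c + r + 1 ∧ c - r ≤ N ∧ -(N : ℤ) ≤ c - r := by
  simp only [aztecSquares, Finset.mem_filter, Finset.mem_product, Finset.mem_Icc]
  rcases abs_cases c with h1 | h1 <;> rcases abs_cases (c + 1) with h2 | h2 <;>
    rcases abs_cases r with h3 | h3 <;> rcases abs_cases (r + 1) with h4 | h4 <;> omega

theorem mem_squares {d : Domino} {c r : ℤ} : (c, r) ∈ d.squares ↔
    d = .horizontal c r ∨ d = .horizontal (c - 1) r ∨ d = .vertical c r ∨
      d = .vertical c (r - 1) := by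
  cases d <;> simp [Domino.squares] <;> omega

theorem mem_aztecDominoes {N : ℕ} {d : Domino} :
    d ∈ aztecDominoes N ↔ d.squares ⊆ aztecSquares N := by
  simp only [aztecDominoes, Finset.mem_filter, Finset.mem_union, Finset.mem_image, Prod.exists]
  refine ⟨fun h => h.2, fun h => ⟨?_, h⟩⟩
  cases d with
  | horizontal c r => exact Or.inl ⟨c, r, h (by simp [Domino.squares]), rfl⟩
  | vertical c r => exact Or.inr ⟨c, r, h (by simp [Domino.squares]), rfl⟩

/-- The South domino whose left square is at line-time `2 k + 1` and height `h`, for the diamond of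
size `M + 1`. -/
def southDomino (M : ℕ) (k h : ℤ) : Domino := .horizontal (2 * k - M + h) h

/-- The East domino whose upper square is at line-time `2 k + 1` and height `h`, for the diamond of
size `M + 1`. -/
def eastDomino (M : ℕ) (k h : ℤ) : Domino := .vertical (2 * k - M + h) (h - 1)

/-- The West domino whose lower square is at line-time `2 k + 1` and height `h`, for the diamond of
size `M + 1`. -/
def westDomino (M : ℕ) (k h : ℤ) : Domino := .vertical (2 * k - M + h) h

/-- The North domino whose right square is at line-time `2 k + 1` and height `h`, for the diamond of
size `M + 1`. -/
def northDomino (M : ℕ) (k h : ℤ) : Domino := .horizontal (2 * k - M + h - 1) h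

theorem Domino.exists_kind (M : ℕ) (d : Domino) : ∃ k h, d = southDomino M k h ∨
    d = eastDomino M k h ∨ d = westDomino M k h ∨ d = northDomino M k h := by
  cases d with
  | horizontal c r =>
    rcases Int.emod_two_eq_zero_or_one (c - r + M) with h | h
    · exact ⟨(c - r + M) / 2, r, Or.inl (by
        simp only [southDomino, Domino.horizontal.injEq, and_true]; omega)⟩
    · exact ⟨(c - r + M + 1) / 2, r, Or.inr (Or.inr (Or.inr (by
        simp only [northDomino, Domino.horizontal.injEq, and_true]; omega)))⟩
  | vertical c r =>
    rcases Int.emod_two_eq_zero_or_one (c - r + M) with h | h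
    · exact ⟨(c - r + M) / 2, r, Or.inr (Or.inr (Or.inl (by
        simp only [westDomino, Domino.vertical.injEq, and_true]; omega)))⟩
    · exact ⟨(c - r + M - 1) / 2, r + 1, Or.inr (Or.inl (by
        simp only [eastDomino, Domino.vertical.injEq]; omega))⟩

/-- The indicator of a domino in a set of dominoes. -/
def ind (T : Finset Domino) (d : Domino) : ℤ := if d ∈ T then 1 else 0

theorem ind_eq_zero_or_one (T : Finset Domino) (d : Domino) : ind T d = 0 ∨ ind T d = 1 := by
  unfold ind
  split_ifs <;> simp

theorem ind_eq_one {T : Finset Domino} {d : Domino} : ind T d = 1 ↔ d ∈ T := by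
  unfold ind
  split_ifs with h <;> simp [h]

theorem existsUnique_domino_iff {T : Finset Domino} {c r : ℤ} :
    (∃! d : Domino, d ∈ T ∧ (c, r) ∈ d.squares) ↔
      ind T (.horizontal c r) + ind T (.horizontal (c - 1) r) + ind T (.vertical c r) +
        ind T (.vertical c (r - 1)) = 1 := by
  have hset : T.filter (fun d => (c, r) ∈ d.squares) =
      ({.horizontal c r, .horizontal (c - 1) r, .vertical c r, .vertical c (r - 1)} :
        Finset Domino).filter (· ∈ T) := by
    ext d
    simp only [Finset.mem_filter, mem_squares, Finset.mem_insert, Finset.mem_singleton]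
    tauto
  have hcard : (∃! d : Domino, d ∈ T ∧ (c, r) ∈ d.squares) ↔
      (T.filter (fun d => (c, r) ∈ d.squares)).card = 1 := by
    rw [Finset.card_eq_one, ExistsUnique]
    refine exists_congr fun d => ?_
    rw [Finset.eq_singleton_iff_unique_mem]
    simp only [Finset.mem_filter]
  rw [hcard, hset, ← Nat.cast_inj (R := ℤ), Finset.card_filter, Nat.cast_sum,
    Finset.sum_insert (by simp; omega), Finset.sum_insert (by simp),
    Finset.sum_insert (by simp; omega), Finset.sum_singleton]
  simp only [ind, Nat.cast_ite, Nat.cast_one, Nat.cast_zero, add_assoc]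

/-- The local rules for the indicators `s, e, w, n` of South, East, West and North dominoes in a
tiling of the Aztec diamond of size `M + 1`, indexed by the level `k` and the height `h` of the square
at the odd line-time `2 k + 1`.  The supports say that the dominoes stay inside the diamond, and the
two equations say that every square, at an odd or at an even line-time, is covered once. -/
structure IsFlow (M : ℕ) (s e w n : ℤ → ℤ → ℤ) : Prop where
  s_bit : ∀ k h, s k h = 0 ∨ s k h = 1
  e_bit : ∀ k h, e k h = 0 ∨ e k h = 1
  w_bit : ∀ k h, w k h = 0 ∨ w k h = 1
  n_bit : ∀ k h, n k h = 0 ∨ n k h = 1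
  s_supp : ∀ k h : ℤ, s k h = 1 → 0 ≤ k ∧ k ≤ (M : ℤ) ∧ -k - 1 ≤ h ∧ h ≤ M - k - 1
  e_supp : ∀ k h : ℤ, e k h = 1 → 0 ≤ k ∧ k ≤ M ∧ -k ≤ h ∧ h ≤ M - k
  w_supp : ∀ k h : ℤ, w k h = 1 → 0 ≤ k ∧ k ≤ M ∧ -k - 1 ≤ h ∧ h ≤ M - k - 1
  n_supp : ∀ k h : ℤ, n k h = 1 → 0 ≤ k ∧ k ≤ M ∧ -k ≤ h ∧ h ≤ M - k
  odd : ∀ k h : ℤ, 0 ≤ k → k ≤ M → -k - 1 ≤ h → h ≤ M - k → s k h + e k h + w k h + n k h = 1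
  even : ∀ k h : ℤ, 0 ≤ k → k ≤ M + 1 → -k ≤ h → h ≤ M - k →
    s (k - 1) h + e (k - 1) (h + 1) + w k (h - 1) + n k h = 1

theorem mem_tilings {N : ℕ} {T : Finset Domino} : T ∈ tilings N ↔
    (∀ d ∈ T, d.squares ⊆ aztecSquares N) ∧
      ∀ q ∈ aztecSquares N, ∃! d : Domino, d ∈ T ∧ q ∈ d.squares := by
  simp only [tilings, Finset.mem_filter, Finset.mem_powerset, Finset.subset_iff,
    mem_aztecDominoes]

theorem southDomino_subset {M : ℕ} {k h : ℤ} : (southDomino M k h).squares ⊆ aztecSquares (M + 1) ↔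
    0 ≤ k ∧ k ≤ M ∧ -k - 1 ≤ h ∧ h ≤ M - k - 1 := by
  simp only [southDomino, Domino.squares, Finset.insert_subset_iff, Finset.singleton_subset_iff,
    mem_aztecSquares]
  push_cast
  omega

theorem eastDomino_subset {M : ℕ} {k h : ℤ} : (eastDomino M k h).squares ⊆ aztecSquares (M + 1) ↔
    0 ≤ k ∧ k ≤ M ∧ -k ≤ h ∧ h ≤ M - k := by
  simp only [eastDomino, Domino.squares, Finset.insert_subset_iff, Finset.singleton_subset_iff,
    mem_aztecSquares]
  push_cast
  omega

theorem westDomino_subset {M : ℕ} {k h : ℤ} : (westDomino M k h).squares ⊆ aztecSquares (M + 1) ↔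
    0 ≤ k ∧ k ≤ M ∧ -k - 1 ≤ h ∧ h ≤ M - k - 1 := by
  simp only [westDomino, Domino.squares, Finset.insert_subset_iff, Finset.singleton_subset_iff,
    mem_aztecSquares]
  push_cast
  omega

theorem northDomino_subset {M : ℕ} {k h : ℤ} : (northDomino M k h).squares ⊆ aztecSquares (M + 1) ↔
    0 ≤ k ∧ k ≤ M ∧ -k ≤ h ∧ h ≤ M - k := by
  simp only [northDomino, Domino.squares, Finset.insert_subset_iff, Finset.singleton_subset_iff,
    mem_aztecSquares]
  push_cast
  omega

theorem odd_square_covered_iff {M : ℕ} {T : Finset Domino} {k h : ℤ} :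
    (∃! d : Domino, d ∈ T ∧ (2 * k - M + h, h) ∈ d.squares) ↔
      ind T (southDomino M k h) + ind T (eastDomino M k h) + ind T (westDomino M k h) +
        ind T (northDomino M k h) = 1 := by
  rw [existsUnique_domino_iff, southDomino, eastDomino, westDomino, northDomino]
  omega

theorem even_square_covered_iff {M : ℕ} {T : Finset Domino} {k h : ℤ} :
    (∃! d : Domino, d ∈ T ∧ (2 * k - M + h - 1, h) ∈ d.squares) ↔
      ind T (southDomino M (k - 1) h) + ind T (eastDomino M (k - 1) (h + 1)) +
        ind T (westDomino M k (h - 1)) + ind T (northDomino M k h) = 1 := by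
  rw [existsUnique_domino_iff, southDomino, eastDomino, westDomino, northDomino]
  have h1 : 2 * (k - 1) - (M : ℤ) + h = 2 * k - M + h - 1 - 1 := by ring
  have h2 : 2 * (k - 1) - (M : ℤ) + (h + 1) = 2 * k - M + h - 1 := by ring
  have h3 : 2 * k - (M : ℤ) + (h - 1) = 2 * k - M + h - 1 := by ring
  have h4 : h + 1 - 1 = h := by ring
  rw [h1, h2, h3, h4]
  omega

theorem isFlow_of_mem_tilings {M : ℕ} {T : Finset Domino} (hT : T ∈ tilings (M + 1)) :
    IsFlow M (fun k h => ind T (southDomino M k h)) (fun k h => ind T (eastDomino M k h))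
      (fun k h => ind T (westDomino M k h)) (fun k h => ind T (northDomino M k h)) := by
  obtain ⟨h1, h2⟩ := mem_tilings.1 hT
  refine ⟨fun _ _ => ind_eq_zero_or_one _ _, fun _ _ => ind_eq_zero_or_one _ _,
    fun _ _ => ind_eq_zero_or_one _ _, fun _ _ => ind_eq_zero_or_one _ _,
    fun _ _ h => southDomino_subset.1 (h1 _ (ind_eq_one.1 h)),
    fun _ _ h => eastDomino_subset.1 (h1 _ (ind_eq_one.1 h)),
    fun _ _ h => westDomino_subset.1 (h1 _ (ind_eq_one.1 h)),
    fun _ _ h => northDomino_subset.1 (h1 _ (ind_eq_one.1 h)),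
    fun k h _ _ _ _ => odd_square_covered_iff.1 (h2 _ ?_),
    fun k h _ _ _ _ => even_square_covered_iff.1 (h2 _ ?_)⟩ <;>
  · rw [mem_aztecSquares]
    push_cast
    omega

theorem exists_tiling_of_isFlow {M : ℕ} {s e w n : ℤ → ℤ → ℤ} (F : IsFlow M s e w n) :
    ∃ T ∈ tilings (M + 1), ∀ k h, ind T (southDomino M k h) = s k h ∧
      ind T (eastDomino M k h) = e k h ∧ ind T (westDomino M k h) = w k h ∧
        ind T (northDomino M k h) = n k h := by
  classical
  set T := (aztecDominoes (M + 1)).filter fun d => ∃ k h,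
    (d = southDomino M k h ∧ s k h = 1) ∨ (d = eastDomino M k h ∧ e k h = 1) ∨
      (d = westDomino M k h ∧ w k h = 1) ∨ (d = northDomino M k h ∧ n k h = 1) with hT
  have hind : ∀ {d : Domino} {v : ℤ}, (v = 0 ∨ v = 1) → (d ∈ T ↔ v = 1) → ind T d = v := by
    intro d v hv h
    unfold ind
    split_ifs with hd
    · exact (h.1 hd).symm
    · exact (hv.resolve_right fun hc => hd (h.2 hc)).symm
  have hs : ∀ k h, ind T (southDomino M k h) = s k h := by
    refine fun k h => hind (F.s_bit k h) ?_
    rw [hT, Finset.mem_filter, mem_aztecDominoes, southDomino_subset]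
    constructor
    · rintro ⟨-, k', h', hc | hc | hc | hc⟩ <;>
        simp only [southDomino, eastDomino, westDomino, northDomino, Domino.horizontal.injEq,
          reduceCtorEq, false_and] at hc
      · obtain ⟨rfl, rfl⟩ : k' = k ∧ h' = h := by omega
        exact hc.2
      · omega
    · exact fun hc => ⟨F.s_supp k h hc, k, h, Or.inl ⟨rfl, hc⟩⟩
  have he : ∀ k h, ind T (eastDomino M k h) = e k h := by
    refine fun k h => hind (F.e_bit k h) ?_
    rw [hT, Finset.mem_filter, mem_aztecDominoes, eastDomino_subset]
    constructor
    · rintro ⟨-, k', h', hc | hc | hc | hc⟩ <;>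
        simp only [southDomino, eastDomino, westDomino, northDomino, Domino.vertical.injEq,
          reduceCtorEq, false_and] at hc
      · obtain ⟨rfl, rfl⟩ : k' = k ∧ h' = h := by omega
        exact hc.2
      · omega
    · exact fun hc => ⟨F.e_supp k h hc, k, h, Or.inr (Or.inl ⟨rfl, hc⟩)⟩
  have hw : ∀ k h, ind T (westDomino M k h) = w k h := by
    refine fun k h => hind (F.w_bit k h) ?_
    rw [hT, Finset.mem_filter, mem_aztecDominoes, westDomino_subset]
    constructor
    · rintro ⟨-, k', h', hc | hc | hc | hc⟩ <;>
        simp only [southDomino, eastDomino, westDomino, northDomino, Domino.vertical.injEq,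
          reduceCtorEq, false_and] at hc
      · omega
      · obtain ⟨rfl, rfl⟩ : k' = k ∧ h' = h := by omega
        exact hc.2
    · exact fun hc => ⟨F.w_supp k h hc, k, h, Or.inr (Or.inr (Or.inl ⟨rfl, hc⟩))⟩
  have hn : ∀ k h, ind T (northDomino M k h) = n k h := by
    refine fun k h => hind (F.n_bit k h) ?_
    rw [hT, Finset.mem_filter, mem_aztecDominoes, northDomino_subset]
    constructor
    · rintro ⟨-, k', h', hc | hc | hc | hc⟩ <;>
        simp only [southDomino, eastDomino, westDomino, northDomino, Domino.horizontal.injEq,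
          reduceCtorEq, false_and] at hc
      · omega
      · obtain ⟨rfl, rfl⟩ : k' = k ∧ h' = h := by omega
        exact hc.2
    · exact fun hc => ⟨F.n_supp k h hc, k, h, Or.inr (Or.inr (Or.inr ⟨rfl, hc⟩))⟩
  refine ⟨T, mem_tilings.2 ⟨fun d hd => ?_, ?_⟩, fun k h => ⟨hs k h, he k h, hw k h, hn k h⟩⟩
  · exact mem_aztecDominoes.1 (Finset.mem_filter.1 hd).1
  · rintro ⟨c, r⟩ hq
    rw [mem_aztecSquares] at hq
    push_cast at hq
    rcases Int.emod_two_eq_zero_or_one (c - r + M) with h | h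
    · obtain ⟨k, hk⟩ : ∃ k, c = 2 * k - M + r := ⟨(c - r + M) / 2, by omega⟩
      subst hk
      rw [odd_square_covered_iff, hs, he, hw, hn]
      exact F.odd k r (by omega) (by omega) (by omega) (by omega)
    · obtain ⟨k, hk⟩ : ∃ k, c = 2 * k - M + r - 1 := ⟨(c - r + M + 1) / 2, by omega⟩
      subst hk
      rw [even_square_covered_iff, hs, he, hw, hn]
      exact F.even k r (by omega) (by omega) (by omega) (by omega)

theorem leavingHeights_eq (M : ℕ) (T : Finset Domino) (k : ℤ) :
    leavingHeights (M + 1) T (2 * k + 1) =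
      {h | southDomino M k h ∈ T ∨ eastDomino M k h ∈ T} := by
  ext h
  simp only [leavingHeights, Set.mem_ofPred_eq]
  constructor
  · rintro ⟨d, hd, h', hdh⟩
    cases d with
    | horizontal c r =>
      simp only [Domino.lgvEdge] at hdh
      split_ifs at hdh
      simp only [Option.some.injEq, Prod.mk.injEq] at hdh
      push_cast at hdh
      left
      rwa [show southDomino M k h = .horizontal c r by
        simp only [southDomino, Domino.horizontal.injEq]; omega]
    | vertical c r =>
      simp only [Domino.lgvEdge] at hdh
      split_ifs at hdh <;> simp only [Option.some.injEq, Prod.mk.injEq] at hdh <;> push_cast at hdh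
      · right
        rwa [show eastDomino M k h = .vertical c r by
          simp only [eastDomino, Domino.vertical.injEq]; omega]
      · omega
  · rintro (hd | hd)
    · refine ⟨_, hd, h, ?_⟩
      rw [southDomino, Domino.lgvEdge, if_pos ⟨k - M - 1, by push_cast; ring⟩]
      simp only [Option.some.injEq, Prod.mk.injEq]
      refine ⟨⟨?_, ?_⟩, ?_, ?_⟩ <;> push_cast <;> ring
    · refine ⟨_, hd, h - 1, ?_⟩
      rw [eastDomino, Domino.lgvEdge, if_pos ⟨k - M, by push_cast; ring⟩]
      simp only [Option.some.injEq, Prod.mk.injEq]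
      refine ⟨⟨?_, ?_⟩, ?_, ?_⟩ <;> push_cast <;> ring

theorem arrivingHeights_eq (M : ℕ) (T : Finset Domino) (k : ℤ) :
    arrivingHeights (M + 1) T (2 * k + 2) =
      {h | southDomino M k h ∈ T ∨ eastDomino M k (h + 1) ∈ T} := by
  ext h
  simp only [arrivingHeights, Set.mem_ofPred_eq]
  constructor
  · rintro ⟨d, hd, h', hdh⟩
    cases d with
    | horizontal c r =>
      simp only [Domino.lgvEdge] at hdh
      split_ifs at hdh
      simp only [Option.some.injEq, Prod.mk.injEq] at hdh
      push_cast at hdh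
      left
      rwa [show southDomino M k h = .horizontal c r by
        simp only [southDomino, Domino.horizontal.injEq]; omega]
    | vertical c r =>
      simp only [Domino.lgvEdge] at hdh
      split_ifs at hdh <;> simp only [Option.some.injEq, Prod.mk.injEq] at hdh <;> push_cast at hdh
      · right
        rwa [show eastDomino M k (h + 1) = .vertical c r by
          simp only [eastDomino, Domino.vertical.injEq]; omega]
      · omega
  · rintro (hd | hd)
    · refine ⟨_, hd, h, ?_⟩
      rw [southDomino, Domino.lgvEdge, if_pos ⟨k - M - 1, by push_cast; ring⟩]
      simp only [Option.some.injEq, Prod.mk.injEq]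
      refine ⟨⟨?_, ?_⟩, ?_, ?_⟩ <;> push_cast <;> ring
    · refine ⟨_, hd, h + 1, ?_⟩
      rw [eastDomino, Domino.lgvEdge, if_pos ⟨k - M, by push_cast; ring⟩]
      simp only [Option.some.injEq, Prod.mk.injEq]
      refine ⟨⟨?_, ?_⟩, ?_, ?_⟩ <;> push_cast <;> ring

open Classical in
/-- East and West dominoes are equinumerous: give every square the weight `± (its height)`, with a
sign that alternates as on a checkerboard, and sum over the diamond, which is symmetric under a
reflection that exchanges the two colours. -/
theorem verticalCount_eq {M : ℕ} {T : Finset Domino} (hT : T ∈ tilings (M + 1)) :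
    verticalCount T = 2 * (T.filter fun d => ∃ k h, d = eastDomino M k h).card := by
  obtain ⟨h1, h2⟩ := mem_tilings.1 hT
  set g : ℤ × ℤ → ℤ := fun q => if (q.1 - q.2 + M) % 2 = 0 then q.2 else -q.2 with hg
  have hzero : ∑ q ∈ aztecSquares (M + 1), g q = 0 := by
    refine Finset.sum_involution (fun q _ => (-1 - q.1, q.2)) ?_ ?_ ?_ ?_
    · rintro ⟨c, r⟩ _
      simp only [hg]
      split_ifs <;> omega
    · rintro ⟨c, r⟩ _ _ hc
      simp only [Prod.mk.injEq] at hc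
      omega
    · rintro ⟨c, r⟩ hq
      rw [mem_aztecSquares] at hq ⊢
      omega
    · rintro ⟨c, r⟩ _
      simp
  have hcover : ∑ q ∈ aztecSquares (M + 1), g q = ∑ d ∈ T, ∑ q ∈ d.squares, g q := by
    have hd : ∀ d ∈ T, ∑ q ∈ d.squares, g q =
        ∑ q ∈ aztecSquares (M + 1), if q ∈ d.squares then g q else 0 := by
      intro d hd
      rw [← Finset.sum_filter, Finset.filter_mem_eq_inter, Finset.inter_eq_right.2 (h1 d hd)]
    rw [Finset.sum_congr rfl hd, Finset.sum_comm]
    refine Finset.sum_congr rfl fun q hq => ?_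
    obtain ⟨d, ⟨hdT, hdq⟩, hu⟩ := h2 q hq
    rw [Finset.sum_eq_single d, if_pos hdq]
    · exact fun d' hd' hne => if_neg fun hc => hne (hu d' ⟨hd', hc⟩)
    · exact fun h => absurd hdT h
  have hdom : ∀ d : Domino, ∑ q ∈ d.squares, g q =
      2 * (if ∃ k h, d = eastDomino M k h then 1 else 0) - if d.IsVertical then 1 else 0 := by
    intro d
    obtain ⟨k, h, rfl | rfl | rfl | rfl⟩ := d.exists_kind M
    · rw [southDomino, Domino.squares, Finset.sum_pair (by simp), if_neg (by simp [eastDomino]),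
        if_neg (by simp [Domino.IsVertical])]
      simp only [hg]
      split_ifs <;> omega
    · rw [if_pos ⟨k, h, rfl⟩, eastDomino, Domino.squares, Finset.sum_pair (by simp),
        if_pos (by simp [Domino.IsVertical])]
      simp only [hg]
      split_ifs <;> omega
    · rw [westDomino, Domino.squares, Finset.sum_pair (by simp), if_neg,
        if_pos (by simp [Domino.IsVertical])]
      · simp only [hg]
        split_ifs <;> omega
      · rintro ⟨k', h', hc⟩
        simp only [eastDomino, Domino.vertical.injEq] at hc
        omega
    · rw [northDomino, Domino.squares, Finset.sum_pair (by simp), if_neg (by simp [eastDomino]),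
        if_neg (by simp [Domino.IsVertical])]
      simp only [hg]
      split_ifs <;> omega
  rw [hcover, Finset.sum_congr rfl fun d _ => hdom d, Finset.sum_sub_distrib, ← Finset.mul_sum,
    Finset.sum_boole, Finset.sum_boole] at hzero
  rw [verticalCount]
  change (T.filter fun d => d.IsVertical).card = _
  omega

/-! ### Counting functions of particle configurations -/

/-- The number of elements of `A` that are at most `h`. -/
def cnt (A : Finset ℤ) (h : ℤ) : ℤ := (A.filter (· ≤ h)).card

theorem cnt_eq_add (A : Finset ℤ) (h : ℤ) : cnt A h = cnt A (h - 1) + if h ∈ A then 1 else 0 := by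
  have hd : A.filter (· ≤ h) = A.filter (· ≤ h - 1) ∪ A.filter (· = h) := by
    rw [← Finset.filter_or]
    exact Finset.filter_congr fun u _ => by omega
  rw [cnt, cnt, hd, Finset.card_union_of_disjoint, Finset.filter_eq']
  · split_ifs <;> simp
  · exact Finset.disjoint_filter.2 fun u _ h1 => by omega

theorem cnt_nonneg (A : Finset ℤ) (h : ℤ) : 0 ≤ cnt A h := Int.natCast_nonneg _

theorem cnt_mono (A : Finset ℤ) {h h' : ℤ} (hh : h ≤ h') : cnt A h ≤ cnt A h' :=
  Nat.cast_le.2 (Finset.card_le_card fun u hu => by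
    simp only [Finset.mem_filter] at hu ⊢
    exact ⟨hu.1, hu.2.trans hh⟩)

theorem cnt_eq_zero {A : Finset ℤ} {h : ℤ} (hA : ∀ u ∈ A, h < u) : cnt A h = 0 := by
  rw [cnt, Finset.filter_false_of_mem fun u hu => not_le.2 (hA u hu)]
  rfl

theorem cnt_eq_card {A : Finset ℤ} {h : ℤ} (hA : ∀ u ∈ A, u ≤ h) : cnt A h = A.card := by
  rw [cnt, Finset.filter_true_of_mem hA]

/-- The heights that are occupied by the particles of `x`. -/
def occ {n : ℕ} (x : Weyl n) : Finset ℤ := Finset.univ.image x.1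

theorem mem_occ {n : ℕ} {x : Weyl n} {h : ℤ} : h ∈ occ x ↔ ∃ i, x.1 i = h := by simp [occ]

theorem card_occ {n : ℕ} (x : Weyl n) : (occ x).card = n := by
  rw [occ, Finset.card_image_of_injective _ x.2.injective, Finset.card_fin]

theorem cnt_occ_le {n : ℕ} (x : Weyl n) (h : ℤ) : cnt (occ x) h ≤ n := by
  have := Finset.card_filter_le (occ x) (· ≤ h)
  rw [card_occ] at this
  unfold cnt
  exact_mod_cast this

theorem cnt_occ_self {n : ℕ} (x : Weyl n) (i : Fin n) : cnt (occ x) (x.1 i) = i + 1 := by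
  have h1 : (occ x).filter (· ≤ x.1 i) = (Finset.Iic i).image x.1 := by
    ext u
    simp only [Finset.mem_filter, mem_occ, Finset.mem_image, Finset.mem_Iic]
    constructor
    · rintro ⟨⟨j, rfl⟩, hj⟩
      exact ⟨j, x.2.le_iff_le.1 hj, rfl⟩
    · rintro ⟨j, hj, rfl⟩
      exact ⟨⟨j, rfl⟩, x.2.monotone hj⟩
  rw [cnt, h1, Finset.card_image_of_injective _ x.2.injective, Fin.card_Iic]
  push_cast
  rfl

theorem cnt_occ_pred {n : ℕ} (x : Weyl n) (i : Fin n) : cnt (occ x) (x.1 i - 1) = i := by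
  have h1 := cnt_eq_add (occ x) (x.1 i)
  rw [cnt_occ_self, if_pos (mem_occ.2 ⟨i, rfl⟩)] at h1
  omega

theorem le_iff_lt_cnt {n : ℕ} (x : Weyl n) (i : Fin n) (h : ℤ) :
    x.1 i ≤ h ↔ (i : ℤ) < cnt (occ x) h := by
  constructor
  · intro hi
    have := cnt_mono (occ x) hi
    rw [cnt_occ_self] at this
    omega
  · intro hi
    by_contra! hc
    have := cnt_mono (occ x) (show h ≤ x.1 i - 1 by omega)
    rw [cnt_occ_pred] at this
    omega

theorem eq_cnt_of_recurrence {A B : Finset ℤ} {f : ℤ → ℤ} {l u c : ℤ}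
    (h0 : f (l - 1) = c + cnt B (l - 1) - cnt A (l - 1))
    (hrec : ∀ h, l ≤ h → h ≤ u →
      f h = f (h - 1) + (if h ∈ B then 1 else 0) - if h ∈ A then 1 else 0) :
    ∀ h, l - 1 ≤ h → h ≤ u → f h = c + cnt B h - cnt A h := by
  intro h hl
  induction h, hl using Int.leInduction with
  | base => exact fun _ => h0
  | succ h hl ih =>
    intro hu
    have h1 := hrec (h + 1) (by omega) hu
    have h2 := cnt_eq_add A (h + 1)
    have h3 := cnt_eq_add B (h + 1)
    rw [add_sub_cancel_right] at h1 h2 h3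
    rw [h1, ih (by omega), h2, h3]
    ring

/-- A step `y → x`, in terms of the indicator `cnt y (h - 1) - cnt x (h - 1)` of jumps to `h`. -/
theorem step_iff_cnt {n : ℕ} (x y : Weyl n) :
    (∀ i, x.1 i = y.1 i + 1 ∨ x.1 i = y.1 i) ↔
      ∀ h, 0 ≤ cnt (occ y) (h - 1) - cnt (occ x) (h - 1) ∧
        cnt (occ y) (h - 1) - cnt (occ x) (h - 1) ≤ if h ∈ occ x then 1 else 0 := by
  constructor
  · intro hst
    have hle : ∀ h, cnt (occ x) h ≤ cnt (occ y) h := by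
      intro h
      by_contra! hc
      have h0 := cnt_nonneg (occ y) h
      have h1 := cnt_occ_le x h
      have h2 := le_iff_lt_cnt x ⟨(cnt (occ y) h).toNat, by omega⟩ h
      have h3 := le_iff_lt_cnt y ⟨(cnt (occ y) h).toNat, by omega⟩ h
      have h4 := hst ⟨(cnt (occ y) h).toNat, by omega⟩
      simp only [Int.toNat_of_nonneg h0] at h2 h3
      omega
    have hle' : ∀ h, cnt (occ y) (h - 1) ≤ cnt (occ x) h := by
      intro h
      by_contra! hc
      have h0 := cnt_nonneg (occ x) h
      have h1 := cnt_occ_le y (h - 1)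
      have h2 := le_iff_lt_cnt x ⟨(cnt (occ x) h).toNat, by omega⟩ h
      have h3 := le_iff_lt_cnt y ⟨(cnt (occ x) h).toNat, by omega⟩ (h - 1)
      have h4 := hst ⟨(cnt (occ x) h).toNat, by omega⟩
      simp only [Int.toNat_of_nonneg h0] at h2 h3
      omega
    intro h
    have h1 := hle (h - 1)
    have h2 := hle' h
    have h3 := cnt_eq_add (occ x) h
    constructor <;> omega
  · intro hE i
    have h1 := (hE (x.1 i + 1)).1
    have h2 := (hE (x.1 i - 1)).2
    have h3 := cnt_occ_self x i
    rw [add_sub_cancel_right] at h1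
    have h4 := (le_iff_lt_cnt y i (x.1 i)).2 (by omega)
    by_contra! hc
    have h5 := (le_iff_lt_cnt y i (x.1 i - 1 - 1)).1 (by omega)
    have h6 := cnt_occ_pred x i
    have h7 := cnt_eq_add (occ x) (x.1 i - 1)
    split_ifs at h2 h7 <;> omega

/-- It suffices to count at the heights of the particles of `x`. -/
theorem interlaces_of_cnt {n : ℕ} {x : Weyl (n + 1)} {y : Weyl n}
    (h : ∀ i, cnt (occ y) (x.1 i) = i) : Interlaces y x := by
  intro i
  have h1 := le_iff_lt_cnt y i (x.1 i.castSucc)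
  have h2 := le_iff_lt_cnt y i (x.1 i.succ)
  have h3 := h i.castSucc
  have h4 := h i.succ
  rw [Fin.val_castSucc] at h3
  rw [Fin.val_succ] at h4
  push_cast at h4
  constructor <;> omega

theorem Interlaces.cnt_bounds {n : ℕ} {x : Weyl (n + 1)} {y : Weyl n} (hyx : Interlaces y x)
    (h : ℤ) : cnt (occ x) h ≤ 1 + cnt (occ y) h ∧ cnt (occ y) h ≤ cnt (occ x) (h - 1) := by
  have h0 := cnt_nonneg (occ y) h
  constructor
  · by_contra! hc
    have h1 := cnt_occ_le x h
    push_cast at h1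
    have h2 := le_iff_lt_cnt x (Fin.succ ⟨(cnt (occ y) h).toNat, by omega⟩) h
    have h3 := le_iff_lt_cnt y ⟨(cnt (occ y) h).toNat, by omega⟩ h
    have h4 := hyx ⟨(cnt (occ y) h).toNat, by omega⟩
    simp only [Fin.val_succ, Nat.cast_add, Int.toNat_of_nonneg h0] at h2 h3
    omega
  · by_contra! hc
    have h1 := cnt_occ_le y h
    have h5 := cnt_nonneg (occ x) (h - 1)
    have h2 := le_iff_lt_cnt x (Fin.castSucc ⟨(cnt (occ x) (h - 1)).toNat, by omega⟩) (h - 1)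
    have h3 := le_iff_lt_cnt y ⟨(cnt (occ x) (h - 1)).toNat, by omega⟩ h
    have h4 := hyx ⟨(cnt (occ x) (h - 1)).toNat, by omega⟩
    simp only [Fin.val_castSucc, Int.toNat_of_nonneg h5] at h2 h3
    omega

/-! ### Flows and configurations -/

/-- The `y`-vectors of a configuration, preceded by the empty vector at the bottom level. -/
def precedingY (y : ∀ k : Fin M, Weyl (k + 1)) : ∀ k : Fin (M + 1), Weyl k :=
  Fin.cases (motive := fun k => Weyl k) ⟨Fin.elim0, fun i => i.elim0⟩ y

theorem forall_interlaces_precedingY {s : Config M} :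
    (∀ k, Interlaces (precedingY s.y k) (s.x k)) ↔ ∀ k : Fin M, Interlaces (s.y k) (s.x k.succ) :=
  ⟨fun h k => h k.succ, fun h k => by
    induction k using Fin.cases with
    | zero => exact fun i => i.elim0
    | succ k => exact h k⟩

namespace IsFlow

variable {s e w n : ℤ → ℤ → ℤ} (F : IsFlow M s e w n)
include F

/-- At most one path leaves from each height. -/
theorem add_bit (k h : ℤ) : s k h + e k h = 0 ∨ s k h + e k h = 1 := by
  have h1 := F.s_bit k h
  have h2 := F.e_bit k h
  have h3 := F.w_bit k h
  have h4 := F.n_bit k h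
  have h5 := F.s_supp k h
  have h6 := F.e_supp k h
  have h7 := F.odd k h
  omega

/-- At most one path arrives at each height. -/
theorem add_bit' (k h : ℤ) : s k h + e k (h + 1) = 0 ∨ s k h + e k (h + 1) = 1 := by
  have h1 := F.s_bit k h
  have h2 := F.e_bit k (h + 1)
  have h3 := F.w_bit (k + 1) (h - 1)
  have h4 := F.n_bit (k + 1) h
  have h5 := F.s_supp k h
  have h6 := F.e_supp k (h + 1)
  have h7 := F.even (k + 1) h
  rw [add_sub_cancel_right] at h7
  omega

/-- The East dominoes balance the particles below a height that leave level `k` (the set `A`) with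
those that arrive at the next line-time (the set `B`). -/
theorem e_eq_cnt {k : ℤ} {A B : Finset ℤ}
    (hA : ∀ h, s k h + e k h = if h ∈ A then 1 else 0)
    (hB : ∀ h, s k h + e k (h + 1) = if h ∈ B then 1 else 0) (h : ℤ) :
    e k h = cnt B (h - 1) - cnt A (h - 1) := by
  have hA' : ∀ u ∈ A, -k - 1 ≤ u := by
    intro u hu
    have h1 := hA u
    rw [if_pos hu] at h1
    have := F.s_bit k u
    have := F.s_supp k u
    have := F.e_supp k u
    omega
  have hB' : ∀ u ∈ B, -k - 1 ≤ u := by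
    intro u hu
    have h1 := hB u
    rw [if_pos hu] at h1
    have := F.s_bit k u
    have := F.s_supp k u
    have := F.e_supp k (u + 1)
    omega
  have hlow : ∀ u, u < -k → e k u = 0 := by
    intro u hu
    have := F.e_bit k u
    have := F.e_supp k u
    omega
  rcases lt_or_ge h (-k) with hh | hh
  · rw [hlow h hh, cnt_eq_zero fun u hu => by have := hB' u hu; omega,
      cnt_eq_zero fun u hu => by have := hA' u hu; omega, sub_zero]
  · have := eq_cnt_of_recurrence (A := A) (B := B) (f := fun h => e k (h + 1)) (l := -k - 1)
      (u := h) (c := 0) (by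
        rw [cnt_eq_zero fun u hu => by have := hB' u hu; omega,
          cnt_eq_zero fun u hu => by have := hA' u hu; omega, hlow _ (by omega)]; rfl)
      (fun u _ _ => by
        have h1 := hA u
        have h2 := hB u
        simp only [sub_add_cancel]
        omega) (h - 1) (by omega) (by omega)
    simp only [sub_add_cancel] at this
    omega

/-- The West dominoes carry upwards the paths that have entered level `k` below a height, namely the
path that starts there and those at the heights `B`, and have not left it yet at the heights `A`. -/
theorem w_eq_cnt {k : ℤ} (hk0 : 0 ≤ k) (hkM : k ≤ M) {A B : Finset ℤ}
    (hA : ∀ h, s k h + e k h = if h ∈ A then 1 else 0)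
    (hB : ∀ h, s (k - 1) h + e (k - 1) (h + 1) = if h ∈ B then 1 else 0) {h : ℤ}
    (hl : -k - 1 ≤ h) (hu : h ≤ M - k) : w k h = 1 + cnt B h - cnt A h := by
  have hA' : ∀ u ∈ A, -k - 1 ≤ u := by
    intro u hu
    have h1 := hA u
    rw [if_pos hu] at h1
    have := F.s_bit k u
    have := F.s_supp k u
    have := F.e_supp k u
    omega
  have hB' : ∀ u ∈ B, -k ≤ u := by
    intro u hu
    have h1 := hB u
    rw [if_pos hu] at h1
    have := F.s_bit (k - 1) u
    have := F.s_supp (k - 1) u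
    have := F.e_supp (k - 1) (u + 1)
    omega
  refine eq_cnt_of_recurrence (l := -k) (u := M - k) ?_ (fun u h1 h2 => ?_) h hl hu
  · rw [cnt_eq_add A, cnt_eq_zero fun u hu => by have := hB' u hu; omega,
      cnt_eq_zero fun u hu => by have := hA' u hu; omega]
    have h1 := hA (-k - 1)
    have h2 := F.odd k (-k - 1) hk0 hkM (by omega) (by omega)
    have h3 := F.n_bit k (-k - 1)
    have h4 := F.n_supp k (-k - 1)
    omega
  · have h3 := hA u
    have h4 := hB u
    have h5 := F.odd k u hk0 hkM (by omega) (by omega)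
    have h6 := F.even k u hk0 (by omega) (by omega) (by omega)
    omega

end IsFlow

/-- The flow with South and East indicators `s` and `e` has the particles of the configuration `c`. -/
def Carries (s e : ℤ → ℤ → ℤ) (c : Config M) : Prop :=
  (∀ (k : Fin (M + 1)) (h : ℤ), s k h + e k h = if h ∈ occ (c.x k) then 1 else 0) ∧
    ∀ (k : Fin M) (h : ℤ), s k h + e k (h + 1) = if h ∈ occ (c.y k) then 1 else 0

theorem hasLineEnsemble_iff {T : Finset Domino} (hT : T ∈ tilings (M + 1)) (c : Config M) :
    HasLineEnsemble M T c ↔ Carries (fun k h => ind T (southDomino M k h))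
      (fun k h => ind T (eastDomino M k h)) c := by
  have F := isFlow_of_mem_tilings hT
  refine and_congr (forall_congr' fun k => ?_) (forall_congr' fun k => ?_)
  · rw [leavingHeights_eq, Set.ext_iff]
    refine forall_congr' fun h => ?_
    have h1 := F.add_bit k h
    have h2 := F.s_bit k h
    have h3 := F.e_bit k h
    simp only [Set.mem_range, Set.mem_ofPred_eq, ← ind_eq_one, ← mem_occ] at h1 h2 h3 ⊢
    by_cases hh : h ∈ occ (c.x k)
    · simp only [hh, if_true, true_iff]; omega
    · simp only [hh, if_false, false_iff]; omega
  · rw [arrivingHeights_eq, Set.ext_iff]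
    refine forall_congr' fun h => ?_
    have h1 := F.add_bit' k h
    have h2 := F.s_bit k h
    have h3 := F.e_bit k (h + 1)
    simp only [Set.mem_range, Set.mem_ofPred_eq, ← ind_eq_one, ← mem_occ] at h1 h2 h3 ⊢
    by_cases hh : h ∈ occ (c.y k)
    · simp only [hh, if_true, true_iff]; omega
    · simp only [hh, if_false, false_iff]; omega

theorem mem_occ_packedVector {n : ℕ} {h : ℤ} : h ∈ occ (packedVector n) ↔ -(n : ℤ) ≤ h ∧ h < 0 := by
  rw [mem_occ]
  constructor
  · rintro ⟨i, rfl⟩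
    have := i.is_lt
    simp only [packedVector]
    omega
  · intro hh
    refine ⟨⟨(h + n).toNat, by omega⟩, ?_⟩
    simp only [packedVector]
    omega

namespace IsFlow

variable {s e w n : ℤ → ℤ → ℤ} (F : IsFlow M s e w n) {c : Config M} (hc : Carries s e c)
include F hc

theorem add_eq_completeY (k : Fin (M + 1)) (h : ℤ) :
    s k h + e k (h + 1) = if h ∈ occ (completeY c.y k) then 1 else 0 := by
  induction k using Fin.lastCases with
  | cast k => rw [completeY_castSucc]; exact hc.2 k h
  | last =>
    -- Every square at the last line-time is joined to one at the line-time before it.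
    rw [completeY_last]
    have h1 := F.s_bit M h
    have h2 := F.e_bit M (h + 1)
    have h3 := F.s_supp M h
    have h4 := F.e_supp M (h + 1)
    have h5 := F.w_bit (M + 1) (h - 1)
    have h6 := F.w_supp (M + 1) (h - 1)
    have h7 := F.n_bit (M + 1) h
    have h8 := F.n_supp (M + 1) h
    have h9 := F.even (M + 1) h
    rw [add_sub_cancel_right] at h9
    have h10 := mem_occ_packedVector (n := M + 1) (h := h)
    push_cast at h10
    change s (M : ℤ) h + e (M : ℤ) (h + 1) = _
    split_ifs with hm
    · have := h10.1 hm
      omega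
    · have := mt h10.2 hm
      omega

theorem add_eq_precedingY (k : Fin (M + 1)) (h : ℤ) :
    s (k - 1) h + e (k - 1) (h + 1) = if h ∈ occ (precedingY c.y k) then 1 else 0 := by
  induction k using Fin.cases with
  | zero =>
    have h1 := F.s_bit (-1) h
    have h2 := F.e_bit (-1) (h + 1)
    have h3 := F.s_supp (-1) h
    have h4 := F.e_supp (-1) (h + 1)
    rw [if_neg fun hm => by obtain ⟨i, -⟩ := mem_occ.1 hm; exact i.elim0]
    simp only [Fin.val_zero, Nat.cast_zero, zero_sub]
    omega
  | succ k =>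
    have := hc.2 k h
    have hk : ((k.succ : Fin (M + 1)) : ℤ) - 1 = k := by
      rw [Fin.val_succ, Nat.cast_succ, add_sub_cancel_right]
    rw [hk]
    exact this

theorem e_eq (k : Fin (M + 1)) (h : ℤ) :
    e k h = cnt (occ (completeY c.y k)) (h - 1) - cnt (occ (c.x k)) (h - 1) :=
  F.e_eq_cnt (hc.1 k) (F.add_eq_completeY hc k) h

theorem w_eq (k : Fin (M + 1)) {h : ℤ} (hl : -(k : ℤ) - 1 ≤ h) (hu : h ≤ M - k) :
    w k h = 1 + cnt (occ (precedingY c.y k)) h - cnt (occ (c.x k)) h :=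
  F.w_eq_cnt (by omega) (by have := k.is_lt; omega) (hc.1 k) (F.add_eq_precedingY hc k) hl hu

theorem step (k : Fin (M + 1)) (i : Fin (k + 1)) :
    (c.x k).1 i = (completeY c.y k).1 i + 1 ∨ (c.x k).1 i = (completeY c.y k).1 i := by
  refine (step_iff_cnt _ _).2 (fun h => ?_) i
  rw [← F.e_eq hc, ← hc.1]
  have := F.s_bit k h
  have := F.e_bit k h
  omega

theorem interlaces (k : Fin (M + 1)) : Interlaces (precedingY c.y k) (c.x k) := by
  refine interlaces_of_cnt fun i => ?_
  have h1 := hc.1 k ((c.x k).1 i)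
  rw [if_pos (mem_occ.2 ⟨i, rfl⟩)] at h1
  have h2 := F.s_bit k ((c.x k).1 i)
  have h3 := F.e_bit k ((c.x k).1 i)
  have h4 := F.s_supp k ((c.x k).1 i)
  have h5 := F.e_supp k ((c.x k).1 i)
  have h6 := F.w_eq hc k (h := (c.x k).1 i) (by omega) (by omega)
  have h7 := F.odd k ((c.x k).1 i) (by omega) (by omega) (by omega) (by omega)
  have h8 := F.w_bit k ((c.x k).1 i)
  have h9 := F.n_bit k ((c.x k).1 i)
  have h10 := cnt_occ_self (c.x k) i
  omega

end IsFlow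

/-- A flow is determined by its configuration. -/
theorem IsFlow.eq_of_carries {s e w n s' e' w' n' : ℤ → ℤ → ℤ} (F : IsFlow M s e w n)
    (F' : IsFlow M s' e' w' n') {c : Config M} (hc : Carries s e c) (hc' : Carries s' e' c)
    (k h : ℤ) : s k h = s' k h ∧ e k h = e' k h ∧ w k h = w' k h ∧ n k h = n' k h := by
  have b1 := F.s_bit k h
  have b2 := F.e_bit k h
  have b3 := F.w_bit k h
  have b4 := F.n_bit k h
  have b1' := F'.s_bit k h
  have b2' := F'.e_bit k h
  have b3' := F'.w_bit k h
  have b4' := F'.n_bit k h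
  have d1 := F.s_supp k h
  have d2 := F.e_supp k h
  have d3 := F.w_supp k h
  have d4 := F.n_supp k h
  have d1' := F'.s_supp k h
  have d2' := F'.e_supp k h
  have d3' := F'.w_supp k h
  have d4' := F'.n_supp k h
  by_cases hk : 0 ≤ k ∧ k ≤ M
  · obtain ⟨j, hj⟩ : ∃ j : Fin (M + 1), (j : ℤ) = k := ⟨⟨k.toNat, by omega⟩, by simp [hk.1]⟩
    have he := (F.e_eq hc j h).trans (F'.e_eq hc' j h).symm
    have hx := (hc.1 j h).trans (hc'.1 j h).symm
    rw [hj] at he hx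
    by_cases hh : -k - 1 ≤ h ∧ h ≤ M - k
    · have hw := (F.w_eq hc j (h := h) (by omega) (by omega)).trans
        (F'.w_eq hc' j (by omega) (by omega)).symm
      rw [hj] at hw
      have h1 := F.odd k h hk.1 hk.2 hh.1 hh.2
      have h2 := F'.odd k h hk.1 hk.2 hh.1 hh.2
      omega
    · omega
  · omega

theorem tiling_unique {T T' : Finset Domino} (hT : T ∈ tilings (M + 1))
    (hT' : T' ∈ tilings (M + 1)) {c : Config M} (hc : HasLineEnsemble M T c)
    (hc' : HasLineEnsemble M T' c) : T = T' := by
  have h := (isFlow_of_mem_tilings hT).eq_of_carries (isFlow_of_mem_tilings hT')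
    ((hasLineEnsemble_iff hT c).1 hc) ((hasLineEnsemble_iff hT' c).1 hc')
  ext d
  rw [← ind_eq_one, ← ind_eq_one]
  obtain ⟨k, u, rfl | rfl | rfl | rfl⟩ := d.exists_kind M
  · rw [(h k u).1]
  · rw [(h k u).2.1]
  · rw [(h k u).2.2.1]
  · rw [(h k u).2.2.2]

/-! ### The configuration of a flow -/

theorem exists_occ_eq {n : ℕ} {A : Finset ℤ} (hA : A.card = n) : ∃ x : Weyl n, occ x = A := by
  refine ⟨⟨A.orderEmbOfFin hA, (A.orderEmbOfFin hA).strictMono⟩, ?_⟩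
  ext u
  rw [mem_occ]
  have := Finset.range_orderEmbOfFin A hA
  rw [Set.ext_iff] at this
  exact this u

namespace IsFlow

variable {s e w n : ℤ → ℤ → ℤ} (F : IsFlow M s e w n)
include F

/-- The heights at which paths leave the odd line-time of level `k`. -/
theorem exists_finset_leaving (k : ℤ) :
    ∃ A : Finset ℤ, (∀ h, s k h + e k h = if h ∈ A then 1 else 0) ∧ ∀ h ∈ A, h ≤ M - k := by
  refine ⟨(Finset.Icc (-k - 1) (M - k)).filter fun h => s k h + e k h = 1, fun h => ?_,
    fun h hh => (Finset.mem_Icc.1 (Finset.mem_filter.1 hh).1).2⟩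
  have h1 := F.add_bit k h
  have h2 := F.s_bit k h
  have h3 := F.s_supp k h
  have h4 := F.e_supp k h
  simp only [Finset.mem_filter, Finset.mem_Icc]
  split_ifs <;> omega

/-- The heights at which paths arrive at the even line-time that follows level `k`. -/
theorem exists_finset_arriving (k : ℤ) :
    ∃ B : Finset ℤ, (∀ h, s k h + e k (h + 1) = if h ∈ B then 1 else 0) ∧
      ∀ h ∈ B, h ≤ M - k - 1 := by
  refine ⟨(Finset.Icc (-k - 1) (M - k - 1)).filter fun h => s k h + e k (h + 1) = 1, fun h => ?_,
    fun h hh => (Finset.mem_Icc.1 (Finset.mem_filter.1 hh).1).2⟩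
  have h1 := F.add_bit' k h
  have h2 := F.s_bit k h
  have h3 := F.s_supp k h
  have h4 := F.e_supp k (h + 1)
  simp only [Finset.mem_filter, Finset.mem_Icc]
  split_ifs <;> omega

theorem card_arriving {k : ℤ} {A B : Finset ℤ}
    (hA : ∀ h, s k h + e k h = if h ∈ A then 1 else 0)
    (hB : ∀ h, s k h + e k (h + 1) = if h ∈ B then 1 else 0)
    (hA' : ∀ h ∈ A, h ≤ M - k) (hB' : ∀ h ∈ B, h ≤ M - k - 1) : B.card = A.card := by
  have h1 := F.e_eq_cnt hA hB (M - k + 1)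
  have h2 := F.e_bit k (M - k + 1)
  have h3 := F.e_supp k (M - k + 1)
  rw [add_sub_cancel_right, cnt_eq_card hA', cnt_eq_card fun h hh => by have := hB' h hh; omega]
    at h1
  omega

theorem card_leaving {k : ℤ} (hk0 : 0 ≤ k) (hkM : k ≤ M) {A B : Finset ℤ}
    (hA : ∀ h, s k h + e k h = if h ∈ A then 1 else 0)
    (hB : ∀ h, s (k - 1) h + e (k - 1) (h + 1) = if h ∈ B then 1 else 0)
    (hA' : ∀ h ∈ A, h ≤ M - k) (hB' : ∀ h ∈ B, h ≤ M - (k - 1) - 1) : A.card = B.card + 1 := by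
  have h1 := F.w_eq_cnt hk0 hkM hA hB (h := M - k) (by omega) le_rfl
  have h2 := F.w_bit k (M - k)
  have h3 := F.w_supp k (M - k)
  rw [cnt_eq_card hA', cnt_eq_card fun h hh => by have := hB' h hh; omega] at h1
  omega

/-- Conservation of paths: one path starts at every level, and none ends before the last one. -/
theorem exists_carries : ∃ c : Config M, Carries s e c := by
  choose A hA hA' using F.exists_finset_leaving
  choose B hB hB' using F.exists_finset_arriving
  have hcard : ∀ k : ℕ, k ≤ M → (A k).card = k + 1 := by
    intro k
    induction k with
    | zero =>
      intro _
      have h0 : B (0 - 1) = ∅ := by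
        refine Finset.eq_empty_of_forall_notMem fun h hh => ?_
        have h1 := hB (0 - 1) h
        rw [if_pos hh] at h1
        have h2 := F.s_bit (0 - 1) h
        have h3 := F.s_supp (0 - 1) h
        have h4 := F.e_supp (0 - 1) (h + 1)
        omega
      have := F.card_leaving le_rfl (by omega) (hA 0) (hB (0 - 1)) (hA' 0) (hB' (0 - 1))
      rw [h0] at this
      simpa using this
    | succ k ih =>
      intro hk
      have h1 := F.card_arriving (hA k) (hB k) (hA' k) (hB' k)
      have h2 := F.card_leaving (k := (k + 1 : ℕ)) (B := B k) (by omega) (by omega) (hA _)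
        (by simpa using hB k) (hA' _) (by simpa using hB' k)
      rw [h2, h1, ih (by omega)]
  have hx : ∀ k : Fin (M + 1), ∃ x : Weyl (k + 1), occ x = A k := fun k =>
    exists_occ_eq (hcard k (by omega))
  have hy : ∀ k : Fin M, ∃ y : Weyl (k + 1), occ y = B k := fun k =>
    exists_occ_eq ((F.card_arriving (hA k) (hB k) (hA' k) (hB' k)).trans (hcard k (by omega)))
  choose x hx using hx
  choose y hy using hy
  exact ⟨⟨x, y⟩, fun k h => by rw [hx]; exact hA k h, fun k h => by rw [hy]; exact hB k h⟩

end IsFlow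

/-! ### The flow of a configuration -/

/-- A function of the levels, extended by zero to all integers. -/
def extendLevels (f : Fin (M + 1) → ℤ → ℤ) (k h : ℤ) : ℤ :=
  if hk : 0 ≤ k ∧ k ≤ M then f ⟨k.toNat, by omega⟩ h else 0

theorem extendLevels_coe (f : Fin (M + 1) → ℤ → ℤ) (k : Fin (M + 1)) (h : ℤ) :
    extendLevels f k h = f k h := by
  rw [extendLevels, dif_pos (by omega)]
  rfl

theorem extendLevels_out (f : Fin (M + 1) → ℤ → ℤ) {k : ℤ} (hk : ¬(0 ≤ k ∧ k ≤ M)) (h : ℤ) :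
    extendLevels f k h = 0 := dif_neg hk

theorem exists_level {k : ℤ} (hk : 0 ≤ k ∧ k ≤ M) : ∃ j : Fin (M + 1), (j : ℤ) = k :=
  ⟨⟨k.toNat, by omega⟩, by simp [hk.1]⟩

/-- The East indicators of a configuration. -/
def eastFlow (c : Config M) : ℤ → ℤ → ℤ := extendLevels fun k h =>
  cnt (occ (completeY c.y k)) (h - 1) - cnt (occ (c.x k)) (h - 1)

/-- The South indicators of a configuration. -/
def southFlow (c : Config M) : ℤ → ℤ → ℤ := extendLevels fun k h =>
  (if h ∈ occ (c.x k) then 1 else 0) -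
    (cnt (occ (completeY c.y k)) (h - 1) - cnt (occ (c.x k)) (h - 1))

/-- The West indicators of a configuration: the path that enters at the bottom is counted too. -/
def westFlow (c : Config M) : ℤ → ℤ → ℤ := extendLevels fun k h =>
  if -(k : ℤ) - 1 ≤ h ∧ h ≤ M - k then
    1 + cnt (occ (precedingY c.y k)) h - cnt (occ (c.x k)) h else 0

/-- The North indicators of a configuration. -/
def northFlow (c : Config M) : ℤ → ℤ → ℤ := extendLevels fun k h =>
  if -(k : ℤ) - 1 ≤ h ∧ h ≤ M - k then
    1 - (if h ∈ occ (c.x k) then 1 else 0) -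
      (1 + cnt (occ (precedingY c.y k)) h - cnt (occ (c.x k)) h) else 0

theorem carries_of_config (c : Config M) : Carries (southFlow c) (eastFlow c) c := by
  refine ⟨fun k h => ?_, fun k h => ?_⟩
  · rw [southFlow, eastFlow, extendLevels_coe, extendLevels_coe]
    ring
  · have h1 := cnt_eq_add (occ (c.x k.castSucc)) h
    have h2 := cnt_eq_add (occ (c.y k)) h
    have hk : (k : ℤ) = (k.castSucc : Fin (M + 1)) := by rw [Fin.val_castSucc]
    rw [hk, southFlow, eastFlow, extendLevels_coe, extendLevels_coe, add_sub_cancel_right]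
    simp only [completeY_castSucc, Fin.val_castSucc] at h1 ⊢
    omega

section

variable {c : Config M}
  (hstep : ∀ k i, (c.x k).1 i = (completeY c.y k).1 i + 1 ∨ (c.x k).1 i = (completeY c.y k).1 i)
  (hint : ∀ k : Fin M, Interlaces (c.y k) (c.x k.succ))
include hstep hint

/-- Particles stay inside the diamond, by descending induction on the level. -/
theorem completeY_bounds (k : Fin (M + 1)) :
    ∀ h ∈ occ (completeY c.y k), -(k : ℤ) - 1 ≤ h ∧ h ≤ M - k - 1 := by
  induction k using Fin.reverseInduction with
  | last =>
    intro h hh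
    rw [completeY_last] at hh
    have := mem_occ_packedVector.1 hh
    simp only [Fin.val_last]
    push_cast at this
    omega
  | cast k ih =>
    intro h hh
    rw [completeY_castSucc] at hh
    obtain ⟨i, rfl⟩ := mem_occ.1 hh
    have h1 := hint k i
    have h2 := hstep k.succ i.castSucc
    have h3 := hstep k.succ i.succ
    have h4 := ih _ (mem_occ.2 ⟨i.castSucc, rfl⟩)
    have h5 := ih _ (mem_occ.2 ⟨i.succ, rfl⟩)
    simp only [Fin.val_succ, Fin.val_castSucc] at h4 h5 ⊢
    push_cast at h4 h5
    omega

theorem x_bounds (k : Fin (M + 1)) : ∀ h ∈ occ (c.x k), -(k : ℤ) - 1 ≤ h ∧ h ≤ M - k := by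
  intro h hh
  obtain ⟨i, rfl⟩ := mem_occ.1 hh
  have h1 := hstep k i
  have h2 := completeY_bounds hstep hint k _ (mem_occ.2 ⟨i, rfl⟩)
  omega

theorem precedingY_bounds (k : Fin (M + 1)) :
    ∀ h ∈ occ (precedingY c.y k), -(k : ℤ) ≤ h ∧ h ≤ M - k := by
  intro h hh
  induction k using Fin.cases with
  | zero => obtain ⟨i, -⟩ := mem_occ.1 hh; exact i.elim0
  | succ k =>
    have h1 := completeY_bounds hstep hint k.castSucc h (by rw [completeY_castSucc]; exact hh)
    simp only [Fin.val_castSucc, Fin.val_succ] at h1 ⊢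
    push_cast
    omega

/-- Inside the diamond the local rules hold by construction, so the point is that the indicators take
the values `0` and `1`, by the step and interlacing conditions, and that no domino leaves the diamond. -/
theorem isFlow_of_config :
    IsFlow M (southFlow c) (eastFlow c) (westFlow c) (northFlow c) := by
  have hE : ∀ (k : Fin (M + 1)) h, 0 ≤ eastFlow c k h ∧
      eastFlow c k h ≤ if h ∈ occ (c.x k) then 1 else 0 := fun k h => by
    rw [eastFlow, extendLevels_coe]
    exact (step_iff_cnt _ _).1 (hstep k) h
  have hSE : ∀ (k : Fin (M + 1)) h, southFlow c k h + eastFlow c k h =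
      if h ∈ occ (c.x k) then 1 else 0 := fun k h => by
    rw [southFlow, eastFlow, extendLevels_coe, extendLevels_coe]
    ring
  have hSE' : ∀ (k : Fin (M + 1)) h, southFlow c k h + eastFlow c k (h + 1) =
      if h ∈ occ (completeY c.y k) then 1 else 0 := fun k h => by
    rw [southFlow, eastFlow, extendLevels_coe, extendLevels_coe, add_sub_cancel_right]
    have h1 := cnt_eq_add (occ (c.x k)) h
    have h2 := cnt_eq_add (occ (completeY c.y k)) h
    omega
  have hW : ∀ (k : Fin (M + 1)) {h}, -(k : ℤ) - 1 ≤ h → h ≤ M - k →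
      westFlow c k h = 1 + cnt (occ (precedingY c.y k)) h - cnt (occ (c.x k)) h :=
    fun k h h1 h2 => by rw [westFlow, extendLevels_coe, if_pos ⟨h1, h2⟩]
  have hN : ∀ (k : Fin (M + 1)) {h}, -(k : ℤ) - 1 ≤ h → h ≤ M - k →
      northFlow c k h = 1 - (if h ∈ occ (c.x k) then 1 else 0) - westFlow c k h :=
    fun k h h1 h2 => by rw [hW k h1 h2, northFlow, extendLevels_coe, if_pos ⟨h1, h2⟩]
  have hW0 : ∀ (k : Fin (M + 1)) {h}, ¬(-(k : ℤ) - 1 ≤ h ∧ h ≤ M - k) → westFlow c k h = 0 :=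
    fun k h h1 => by rw [westFlow, extendLevels_coe, if_neg h1]
  have hN0 : ∀ (k : Fin (M + 1)) {h}, ¬(-(k : ℤ) - 1 ≤ h ∧ h ≤ M - k) → northFlow c k h = 0 :=
    fun k h h1 => by rw [northFlow, extendLevels_coe, if_neg h1]
  have hWpos : ∀ (k : Fin (M + 1)) {h}, -(k : ℤ) - 1 ≤ h → h ≤ M - k → 0 ≤ westFlow c k h ∧
      (if h ∈ occ (c.x k) then 1 else 0) + westFlow c k h ≤ 1 := fun k h h1 h2 => by
    have h3 := (forall_interlaces_precedingY.2 hint k).cnt_bounds h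
    have h4 := cnt_eq_add (occ (c.x k)) h
    rw [hW k h1 h2]
    omega
  have hxb := x_bounds hstep hint
  have hyb := completeY_bounds hstep hint
  have hpb := precedingY_bounds hstep hint
  have hElow : ∀ k : Fin (M + 1), eastFlow c k (-k - 1) = 0 := fun k => by
    rw [eastFlow, extendLevels_coe, cnt_eq_zero fun u hu => by have := hyb k u hu; omega,
      cnt_eq_zero fun u hu => by have := hxb k u hu; omega, sub_zero]
  have hShigh : ∀ k : Fin (M + 1), southFlow c k (M - k) = 0 := fun k => by
    have h1 := cnt_eq_add (occ (c.x k)) (M - k)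
    rw [southFlow, extendLevels_coe, cnt_eq_card (A := occ (completeY c.y k))
      fun u hu => by have := hyb k u hu; omega]
    rw [cnt_eq_card fun u hu => (hxb k u hu).2] at h1
    rw [card_occ] at h1 ⊢
    omega
  have hWhigh : ∀ k : Fin (M + 1), westFlow c k (M - k) = 0 := fun k => by
    rw [hW k (by omega) le_rfl, cnt_eq_card fun u hu => (hxb k u hu).2,
      cnt_eq_card fun u hu => (hpb k u hu).2, card_occ, card_occ]
    push_cast
    ring
  have hNlow : ∀ k : Fin (M + 1), northFlow c k (-k - 1) = 0 := fun k => by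
    have h1 := cnt_eq_add (occ (c.x k)) (-k - 1)
    rw [hN k le_rfl (by omega), hW k le_rfl (by omega), h1,
      cnt_eq_zero fun u hu => by have := hpb k u hu; omega,
      cnt_eq_zero fun u hu => by have := hxb k u hu; omega]
    ring
  have hWN : ∀ (k : Fin (M + 1)) {h}, -(k : ℤ) ≤ h → h ≤ M - k →
      westFlow c k (h - 1) + northFlow c k h = 1 - if h ∈ occ (precedingY c.y k) then 1 else 0 :=
    fun k h h1 h2 => by
      rw [hN k (by omega) h2, hW k (by omega) h2, hW k (by omega) (by omega)]
      have h3 := cnt_eq_add (occ (c.x k)) h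
      have h4 := cnt_eq_add (occ (precedingY c.y k)) h
      omega
  have hSout : ∀ {k : ℤ}, ¬(0 ≤ k ∧ k ≤ M) → ∀ h, southFlow c k h = 0 :=
    fun hk h => extendLevels_out _ hk h
  have hEout : ∀ {k : ℤ}, ¬(0 ≤ k ∧ k ≤ M) → ∀ h, eastFlow c k h = 0 :=
    fun hk h => extendLevels_out _ hk h
  have hWout : ∀ {k : ℤ}, ¬(0 ≤ k ∧ k ≤ M) → ∀ h, westFlow c k h = 0 :=
    fun hk h => extendLevels_out _ hk h
  have hNout : ∀ {k : ℤ}, ¬(0 ≤ k ∧ k ≤ M) → ∀ h, northFlow c k h = 0 :=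
    fun hk h => extendLevels_out _ hk h
  refine ⟨fun k h => ?_, fun k h => ?_, fun k h => ?_, fun k h => ?_, fun k h => ?_, fun k h => ?_,
    fun k h => ?_, fun k h => ?_, fun k h h1 h2 h3 h4 => ?_, fun k h h1 h2 h3 h4 => ?_⟩
  · by_cases hk : 0 ≤ k ∧ k ≤ M
    · obtain ⟨j, rfl⟩ := exists_level hk
      have h5 := hE j h
      have h6 := hSE j h
      split_ifs at h5 h6 <;> omega
    · exact Or.inl (hSout hk h)
  · by_cases hk : 0 ≤ k ∧ k ≤ M
    · obtain ⟨j, rfl⟩ := exists_level hk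
      have h5 := hE j h
      split_ifs at h5 <;> omega
    · exact Or.inl (hEout hk h)
  · by_cases hk : 0 ≤ k ∧ k ≤ M
    · obtain ⟨j, rfl⟩ := exists_level hk
      by_cases hh : -(j : ℤ) - 1 ≤ h ∧ h ≤ M - j
      · have h5 := hWpos j hh.1 hh.2
        split_ifs at h5 <;> omega
      · exact Or.inl (hW0 j hh)
    · exact Or.inl (hWout hk h)
  · by_cases hk : 0 ≤ k ∧ k ≤ M
    · obtain ⟨j, rfl⟩ := exists_level hk
      by_cases hh : -(j : ℤ) - 1 ≤ h ∧ h ≤ M - j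
      · have h5 := hWpos j hh.1 hh.2
        have h6 := hN j hh.1 hh.2
        split_ifs at h5 h6 <;> omega
      · exact Or.inl (hN0 j hh)
    · exact Or.inl (hNout hk h)
  · intro h1
    by_cases hk : 0 ≤ k ∧ k ≤ M
    · obtain ⟨j, rfl⟩ := exists_level hk
      have h5 := hE j h
      have h6 := hSE j h
      have h7 : h ≠ M - j := fun hc => by
        rw [hc, hShigh] at h1
        omega
      have h8 := hxb j h
      split_ifs at h5 h6 with hm
      · have := h8 hm
        omega
      · omega
    · rw [hSout hk] at h1
      omega
  · intro h1
    by_cases hk : 0 ≤ k ∧ k ≤ M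
    · obtain ⟨j, rfl⟩ := exists_level hk
      have h5 := hE j h
      have h7 : h ≠ -j - 1 := fun hc => by
        rw [hc, hElow] at h1
        omega
      have h8 := hxb j h
      split_ifs at h5 with hm
      · have := h8 hm
        omega
      · omega
    · rw [hEout hk] at h1
      omega
  · intro h1
    by_cases hk : 0 ≤ k ∧ k ≤ M
    · obtain ⟨j, rfl⟩ := exists_level hk
      by_cases hh : -(j : ℤ) - 1 ≤ h ∧ h ≤ M - j
      · have h7 : h ≠ M - j := fun hc => by
          rw [hc, hWhigh] at h1
          omega
        omega
      · rw [hW0 j hh] at h1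
        omega
    · rw [hWout hk] at h1
      omega
  · intro h1
    by_cases hk : 0 ≤ k ∧ k ≤ M
    · obtain ⟨j, rfl⟩ := exists_level hk
      by_cases hh : -(j : ℤ) - 1 ≤ h ∧ h ≤ M - j
      · have h7 : h ≠ -j - 1 := fun hc => by
          rw [hc, hNlow] at h1
          omega
        omega
      · rw [hN0 j hh] at h1
        omega
    · rw [hNout hk] at h1
      omega
  · obtain ⟨j, rfl⟩ := exists_level ⟨h1, h2⟩
    rw [hSE, hN j h3 h4]
    ring
  · by_cases hk : k ≤ M
    · obtain ⟨j, rfl⟩ := exists_level ⟨h1, hk⟩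
      have h5 := hWN j h3 h4
      rw [add_assoc, h5]
      induction j using Fin.cases with
      | zero =>
        rw [hSout (by simp), hEout (by simp), if_neg fun hm => by
          obtain ⟨i, -⟩ := mem_occ.1 hm; exact i.elim0]
        ring
      | succ j =>
        have hj : ((j.succ : Fin (M + 1)) : ℤ) - 1 = (j.castSucc : Fin (M + 1)) := by
          rw [Fin.val_succ, Nat.cast_succ, add_sub_cancel_right, Fin.val_castSucc]
        have h6 := hSE' j.castSucc h
        rw [completeY_castSucc] at h6
        rw [hj, h6]
        exact add_sub_cancel _ _
    · obtain rfl : k = M + 1 := by omega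
      have h6 := hSE' (Fin.last M) h
      have hm : h ∈ occ (packedVector (M + 1)) := mem_occ_packedVector.2 (by push_cast; omega)
      rw [completeY_last] at h6
      replace h6 := h6.trans (if_pos hm)
      rw [hWout (by omega), hNout (by omega), add_sub_cancel_right, add_zero, add_zero]
      exact h6

theorem exists_tiling_of_config : ∃ T ∈ tilings (M + 1), HasLineEnsemble M T c := by
  obtain ⟨T, hT, h⟩ := exists_tiling_of_isFlow (isFlow_of_config hstep hint)
  refine ⟨T, hT, (hasLineEnsemble_iff hT c).2 ?_⟩
  obtain ⟨h1, h2⟩ := carries_of_config c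
  refine ⟨fun k u => ?_, fun k u => ?_⟩
  · beta_reduce
    rw [(h k u).1, (h k u).2.1]
    exact h1 k u
  · beta_reduce
    rw [(h k u).1, (h k (u + 1)).2.1]
    exact h2 k u

end

/-! ### The weight of a tiling and the law of its lines -/

theorem one_sub_jumpProb (a : ℝ) : 1 - jumpProb a = (1 + a ^ 2)⁻¹ := by
  have : (1 + a ^ 2 : ℝ) ≠ 0 := by positivity
  unfold jumpProb
  field_simp
  ring

theorem stepMatrix_jumpProb (a : ℝ) {x y : ℤ} (h : y = x + 1 ∨ y = x) :
    stepMatrix (jumpProb a) x y = (1 + a ^ 2)⁻¹ * if y = x + 1 then a ^ 2 else 1 := by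
  rw [stepMatrix, one_sub_jumpProb]
  split_ifs <;> first | omega | simp [jumpProb, div_eq_inv_mul]

theorem pathWeight_jumpProb_ne_zero_iff {a : ℝ} (ha : 0 < a) {c : Config M} :
    pathWeight (fun _ => jumpProb a) c ≠ 0 ↔
      (∀ k i, (c.x k).1 i = (completeY c.y k).1 i + 1 ∨ (c.x k).1 i = (completeY c.y k).1 i) ∧
        ∀ k : Fin M, Interlaces (c.y k) (c.x k.succ) := by
  rw [pathWeight_ne_zero_iff]
  refine and_congr (forall_congr' fun k => ?_) Iff.rfl
  simp only [levelWeight, Finset.prod_ne_zero_iff, Finset.mem_univ, true_imp_iff]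
  refine forall_congr' fun i => ⟨eq_or_eq_of_stepMatrix_ne_zero, fun h => ?_⟩
  rw [stepMatrix_jumpProb a h]
  split_ifs <;> positivity

/-- The particles, over all levels, that jump between the two line-times of their level. -/
def jumps (c : Config M) : Finset (Σ k : Fin (M + 1), Fin (k + 1)) :=
  Finset.univ.filter fun σ => (c.x σ.1).1 σ.2 = (completeY c.y σ.1).1 σ.2 + 1

/-- The total weight `(1 + a²)^{N(N+1)/2}` of the tilings of the Aztec diamond: there is one factor
for each particle of a configuration. -/
noncomputable def totalWeight (a : ℝ) (M : ℕ) : ℝ :=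
  (1 + a ^ 2) ^ Fintype.card (Σ k : Fin (M + 1), Fin (k + 1))

theorem pathWeight_jumpProb (a : ℝ) {c : Config M}
    (hstep : ∀ k i, (c.x k).1 i = (completeY c.y k).1 i + 1 ∨
      (c.x k).1 i = (completeY c.y k).1 i)
    (hint : ∀ k : Fin M, Interlaces (c.y k) (c.x k.succ)) :
    pathWeight (fun _ => jumpProb a) c = (a ^ 2) ^ (jumps c).card / totalWeight a M := by
  classical
  have h1 : ∏ k : Fin M, (if Interlaces (c.y k) (c.x k.succ) then (1 : ℝ) else 0) = 1 :=
    Finset.prod_eq_one fun k _ => if_pos (hint k)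
  have h2 : ∏ k, levelWeight (jumpProb a) (completeY c.y k) (c.x k) =
      ∏ σ : (Σ k : Fin (M + 1), Fin (k + 1)), ((1 + a ^ 2)⁻¹ *
        if (c.x σ.1).1 σ.2 = (completeY c.y σ.1).1 σ.2 + 1 then a ^ 2 else 1) := by
    rw [Fintype.prod_sigma]
    exact Finset.prod_congr rfl fun k _ => Finset.prod_congr rfl fun i _ =>
      stepMatrix_jumpProb a (hstep k i)
  rw [pathWeight, h1, mul_one, h2, Finset.prod_mul_distrib, Finset.prod_const, ← Finset.prod_filter,
    Finset.prod_const, Finset.card_univ, totalWeight, jumps, inv_pow, div_eq_inv_mul]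

theorem jump_iff_east {s e w n : ℤ → ℤ → ℤ} (F : IsFlow M s e w n) {c : Config M}
    (hc : Carries s e c) (k : Fin (M + 1)) (i : Fin (k + 1)) :
    (c.x k).1 i = (completeY c.y k).1 i + 1 ↔ e k ((c.x k).1 i) = 1 := by
  have h1 := F.e_eq hc k ((c.x k).1 i)
  rw [cnt_occ_pred] at h1
  have h2 := F.step hc k i
  have h3 := le_iff_lt_cnt (completeY c.y k) i ((c.x k).1 i - 1)
  have h4 := F.e_bit k ((c.x k).1 i)
  omega

open Classical in
theorem card_jumps {T : Finset Domino} (hT : T ∈ tilings (M + 1)) {c : Config M}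
    (hc : HasLineEnsemble M T c) :
    (jumps c).card = (T.filter fun d => ∃ k h, d = eastDomino M k h).card := by
  have F := isFlow_of_mem_tilings hT
  have hc' := (hasLineEnsemble_iff hT c).1 hc
  have hinj : ∀ {k h k' h' : ℤ}, eastDomino M k h = eastDomino M k' h' → k = k' ∧ h = h' := by
    intro k h k' h' hd
    simp only [eastDomino, Domino.vertical.injEq] at hd
    omega
  refine Finset.card_bij (fun σ _ => eastDomino M σ.1 ((c.x σ.1).1 σ.2)) ?_ ?_ ?_
  · intro σ hσ
    simp only [jumps, Finset.mem_filter, Finset.mem_univ, true_and] at hσ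
    exact Finset.mem_filter.2 ⟨ind_eq_one.1 ((jump_iff_east F hc' _ _).1 hσ), _, _, rfl⟩
  · rintro ⟨k, i⟩ _ ⟨k', i'⟩ _ hd
    obtain ⟨h1, h2⟩ := hinj hd
    obtain rfl : k = k' := Fin.ext (by exact_mod_cast h1)
    exact congrArg (Sigma.mk k) ((c.x k).2.injective h2)
  · intro d hd
    obtain ⟨hdT, k, h, rfl⟩ := Finset.mem_filter.1 hd
    have he := ind_eq_one.2 hdT
    have hk := F.e_supp k h he
    obtain ⟨j, rfl⟩ := exists_level (M := M) ⟨hk.1, hk.2.1⟩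
    have hx := hc'.1 j h
    have hs := F.s_bit j h
    have hm : h ∈ occ (c.x j) := by
      by_contra hm
      rw [if_neg hm] at hx
      beta_reduce at hx hs
      omega
    obtain ⟨i, rfl⟩ := mem_occ.1 hm
    refine ⟨⟨j, i⟩, ?_, rfl⟩
    simp only [jumps, Finset.mem_filter, Finset.mem_univ, true_and]
    exact (jump_iff_east F hc' j i).2 he

/-- The weight of a tiling is the product weight of its lines, up to a constant. -/
theorem pow_verticalCount_eq {a : ℝ} {T : Finset Domino} (hT : T ∈ tilings (M + 1)) {c : Config M}
    (hc : HasLineEnsemble M T c) :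
    a ^ verticalCount T / totalWeight a M = pathWeight (fun _ => jumpProb a) c := by
  have F := isFlow_of_mem_tilings hT
  have hc' := (hasLineEnsemble_iff hT c).1 hc
  rw [pathWeight_jumpProb a (F.step hc') (forall_interlaces_precedingY.1 (F.interlaces hc')),
    verticalCount_eq hT, pow_mul, card_jumps hT hc]

theorem HasLineEnsemble.unique {T : Finset Domino} {c c' : Config M}
    (hc : HasLineEnsemble M T c) (hc' : HasLineEnsemble M T c') : c = c' := by
  obtain ⟨x, y⟩ := c
  obtain ⟨x', y'⟩ := c'
  have hx : x = x' := funext fun k => Subtype.ext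
    ((StrictMono.range_inj (x k).2 (x' k).2).1 ((hc.1 k).trans (hc'.1 k).symm))
  have hy : y = y' := funext fun k => Subtype.ext
    ((StrictMono.range_inj (y k).2 (y' k).2).1 ((hc.2 k).trans (hc'.2 k).symm))
  rw [hx, hy]

theorem exists_hasLineEnsemble {T : Finset Domino} (hT : T ∈ tilings (M + 1)) :
    ∃ c, HasLineEnsemble M T c := by
  obtain ⟨c, hc⟩ := (isFlow_of_mem_tilings hT).exists_carries
  exact ⟨c, (hasLineEnsemble_iff hT c).2 hc⟩

/-- The partition function of the Aztec diamond, from the total mass of the law of the chain. -/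
theorem sum_pow_verticalCount {a : ℝ} (ha : 0 < a) :
    ∑ T ∈ tilings (M + 1), a ^ verticalCount T = totalWeight a M := by
  classical
  have hpos : 0 < totalWeight a M := by unfold totalWeight; positivity
  choose c hc using fun T : {T // T ∈ tilings (M + 1)} => exists_hasLineEnsemble T.2
  have hinj : Function.Injective c := fun T T' h =>
    Subtype.ext (tiling_unique T.2 T'.2 (hc T) (h ▸ hc T'))
  have hsum : HasSum (fun T => pathWeight (fun _ => jumpProb a) (c T)) 1 := by
    refine (hinj.hasSum_iff fun s hs => ?_).2 (hasSum_pathWeight_jumpProb a)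
    by_contra hne
    obtain ⟨h1, h2⟩ := (pathWeight_jumpProb_ne_zero_iff ha).1 hne
    obtain ⟨T, hT, hTs⟩ := exists_tiling_of_config h1 h2
    exact hs ⟨⟨T, hT⟩, (hc ⟨T, hT⟩).unique hTs⟩
  have h1 := hsum.unique (hasSum_fintype _)
  simp only [← pow_verticalCount_eq (Subtype.prop _) (hc _)] at h1
  rw [← Finset.sum_div, eq_div_iff hpos.ne', one_mul] at h1
  rw [h1, ← Finset.sum_coe_sort]

theorem aztecLaw_eq_pathWeight {a : ℝ} (ha : 0 < a) (s : Config M) :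
    aztecLaw a M s = pathWeight (fun _ => jumpProb a) s := by
  classical
  rw [aztecLaw, sum_pow_verticalCount ha]
  by_cases hs : ∃ T ∈ tilings (M + 1), HasLineEnsemble M T s
  · obtain ⟨T, hT, hTs⟩ := hs
    rw [Finset.sum_eq_single_of_mem T (Finset.mem_filter.2 ⟨hT, hTs⟩) fun T' hT' hne => ?_]
    · exact pow_verticalCount_eq hT hTs
    · rw [Finset.mem_filter] at hT'
      exact absurd (tiling_unique hT'.1 hT hT'.2 hTs) hne
  · rw [Finset.sum_eq_zero]
    · symm
      by_contra hne
      obtain ⟨h1, h2⟩ := (pathWeight_jumpProb_ne_zero_iff ha).1 hne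
      exact hs (exists_tiling_of_config h1 h2)
    · intro T hT
      rw [Finset.mem_filter] at hT
      exact absurd ⟨T, hT⟩ hs

end AztecChain

theorem mainTheorem1 (a : ℝ) (ha : 0 < a) (M : ℕ) :
    (∀ s : AztecChain.Config M, 0 ≤ AztecChain.chainLaw a M (M + 1) s) ∧
    HasSum (fun s : AztecChain.Config M => AztecChain.chainLaw a M (M + 1) s) 1 ∧
    (∀ s : AztecChain.Config M, s ∉ AztecChain.extendedStateSpace a M →
      AztecChain.chainLaw a M (M + 1) s = 0) ∧
    (∀ s : AztecChain.Config M,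
      AztecChain.aztecLaw a M s = AztecChain.chainLaw a M (M + 1) s) ∧
    ∃ C : ℝ, ∀ s : AztecChain.Config M,
      (AztecChain.chainLaw a M (M + 1) s : ℂ) =
        (C : ℂ) * AztecChain.determinantalWeight (AztecChain.jumpProb a) M s := by
  simp only [AztecChain.chainLaw_final]
  refine ⟨AztecChain.pathWeight_nonneg (fun _ => AztecChain.jumpProb_nonneg a)
      (fun _ => AztecChain.jumpProb_le_one a), AztecChain.hasSum_pathWeight_jumpProb a,
    fun s hs => ?_, AztecChain.aztecLaw_eq_pathWeight ha,
    ((Equiv.Perm.sign (Fin.revPerm (n := M + 1)) : ℤ) : ℝ), fun s => ?_⟩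
  · by_contra hne
    exact hs (AztecChain.mem_extendedStateSpace_of_pathWeight_ne_zero a hne)
  -- The constant is the sign of the permutation that reverses `N` particles, its own inverse.
  · rw [AztecChain.determinantalWeight_eq, Complex.ofReal_intCast, ← mul_assoc, ← Int.cast_mul,
      ← Units.val_mul, Int.units_mul_self]
    simp
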